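/- A convex body in $\mathbb{R}^n$ is a compact convex set with non-empty interior; it is $C^{k,\alpha}$ if its boundary is a $C^{k,\alpha}$ submanifold of $\mathbb{R}^n$, that is, near each of its points the boundary is the graph, over some hyperplane, of a $C^{k,\alpha}$ function. Here, for an integer $k$, a function is $C^{k,\alpha}$ if it is $C^k$ and its partial derivatives of order $k$ are continuous (if $\alpha=0$), locally $\alpha$-Hölder continuous (if $0<\alpha<1$), or locally Lipschitz (if $\alpha=1$); $C^{\infty,\alpha}$ means smooth and $C^{\omega,\alpha}$ means real analytic. For a $C^2$ convex body $C$ let $\nu_C:\partial C\to S^{n-1}$ be the Gauss map given by the unit outer normal, let $G_C$ be the Gaussian curvature, i.e. the determinant of the differential of $\nu_C$, and let $Z_C=\{\nu_C(x): x\in\partial C,\ G_C(x)=0\}$ be the spherical image of its zero set. **Theorem.** Let $A$, $B$ be $C^{k,\alpha}$ convex bodies in $\mathbb{R}^n$, where $k\ge 2$ is an integer, $\infty$ or $\omega$, and $\alpha\in[0,1]$. If $Z_A$ or $Z_B$ is countable, then the set of rotations $R\in SO(n)$ for which the Minkowski sum $R(A)+B=\{R(a)+b : a\in A,\ b\in B\}$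 is a $C^{k,\alpha}$ convex body is comeager in $SO(n)$: it contains a dense $G_\delta$ subset of $SO(n)$. -/

import Mathlib

open Set Topology
open scoped InnerProductSpace NNReal Pointwise

/-- `f` is of class `C^{k,α}` on the open set `U`, locally uniformly: `f` is `C^k` on `U` and, if `k`
is finite, each point of `U` has a neighbourhood on which the `k`-th derivative of `f` is Hölder
continuous with exponent `α`. For `α = 0` the second condition follows from continuity of the `k`-th
derivative, so that `C^{k,0} = C^k`; for `α = 1` it says that the `k`-th derivative is locally
Lipschitz; for `k = ∞` (smooth) and `k = ω` (analytic) it is void. -/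
def IsCkaOn {E F : Type*} [NormedAddCommGroup E] [NormedSpace ℝ E] [NormedAddCommGroup F]
    [NormedSpace ℝ F] (k : WithTop ℕ∞) (α : ℝ≥0) (f : E → F) (U : Set E) : Prop :=
  ContDiffOn ℝ k f U ∧
    ∀ m : ℕ, k = m → ∀ x ∈ U, ∃ V ∈ 𝓝 x, ∃ C : ℝ≥0, HolderOnWith C α (iteratedFDeriv ℝ m f) V

section EuclideanHypersurfaces

variable {E : Type*} [NormedAddCommGroup E] [InnerProductSpace ℝ E]

/-- `S` is an embedded hypersurface (submanifold of codimension one) of class `C^{k,α}`, `k ≥ 1`: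
near each of its points `p` it is the graph of a `C^{k,α}` function `f` over the hyperplane
orthogonal to some unit vector `e`. -/
def IsCkaHypersurface (k : WithTop ℕ∞) (α : ℝ≥0) (S : Set E) : Prop :=
  ∀ p ∈ S, ∃ e : E, ‖e‖ = 1 ∧
    ∃ (f : (ℝ ∙ e)ᗮ → ℝ) (V : Set (ℝ ∙ e)ᗮ) (U : Set E),
      IsOpen V ∧ (ℝ ∙ e)ᗮ.orthogonalProjectionOnto p ∈ V ∧ IsCkaOn k α f V ∧
      IsOpen U ∧ p ∈ U ∧
      ∀ x ∈ U, x ∈ S ↔ ⟪e, x⟫_ℝ = f ((ℝ ∙ e)ᗮ.orthogonalProjectionOnto x)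

/-- A convex body (compact, convex, with non-empty interior) of class `C^{k,α}`: its boundary is a
`C^{k,α}` submanifold. -/
structure IsCkaConvexBody (k : WithTop ℕ∞) (α : ℝ≥0) (C : Set E) : Prop where
  convex : Convex ℝ C
  isCompact : IsCompact C
  nonempty_interior : (interior C).Nonempty
  boundary : IsCkaHypersurface k α (frontier C)

/-- `u` is a unit outer normal vector to the convex set `C` at its point `x`. -/
def IsUnitOuterNormal (C : Set E) (x u : E) : Prop :=
  ‖u‖ = 1 ∧ ∀ y ∈ C, ⟪u, y⟫_ℝ ≤ ⟪u, x⟫_ℝ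

/-- The Gauss map `∂C → S^{n-1}` of a convex body with `C¹` boundary: it sends a boundary point to
the unit outer normal vector there, which is unique. (Values off the boundary are irrelevant.) -/
noncomputable def gaussMap (C : Set E) (x : E) : E :=
  Classical.epsilon (IsUnitOuterNormal C x)

/-- The differential of the Gauss map at a boundary point `x` of a convex body with `C²` boundary, as
an endomorphism of the tangent hyperplane `ν(x)ᗮ` of `∂C` at `x` (which is also the tangent
hyperplane of the unit sphere at `ν(x)`). A derivative of `ν` along the subset `∂C` of the ambient
space is determined on the tangent vectors of `∂C`, to which it is restricted here, and takes them
into `ν(x)ᗮ`, so the projection only adjusts the codomain. -/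
noncomputable def gaussMapDifferential (C : Set E) (x : E) :
    (ℝ ∙ gaussMap C x)ᗮ →ₗ[ℝ] (ℝ ∙ gaussMap C x)ᗮ :=
  ((ℝ ∙ gaussMap C x)ᗮ.orthogonalProjectionOnto ∘L
    fderivWithin ℝ (gaussMap C) (frontier C) x ∘L (ℝ ∙ gaussMap C x)ᗮ.subtypeL).toLinearMap

/-- The Gaussian curvature: the determinant (product of the eigenvalues) of the differential of the
Gauss map. -/
noncomputable def gaussianCurvature (C : Set E) (x : E) : ℝ :=
  LinearMap.det (gaussMapDifferential C x)

/-- The spherical image of the zero set of the Gaussian curvature,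
`Z_C = {ν_C(x) : x ∈ ∂C, G_C(x) = 0}`. -/
def flatSphericalImage (C : Set E) : Set E :=
  gaussMap C '' {x ∈ frontier C | gaussianCurvature C x = 0}

end EuclideanHypersurfaces

/-- The image `R(A)` of a subset of `ℝⁿ` under a rotation `R ∈ SO(n)`. -/
def rotate {n : ℕ} (R : Matrix.specialOrthogonalGroup (Fin n) ℝ)
    (A : Set (EuclideanSpace ℝ (Fin n))) : Set (EuclideanSpace ℝ (Fin n)) :=
  (fun x => Matrix.toEuclideanLin (R : Matrix (Fin n) (Fin n) ℝ) x) '' A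

/-! Regularity of the sum is local. A boundary point of `R(A) + B` with outer normal `u` splits as
`R a + b`, and `u` is also an outer normal of `R(A)` at `R a` and of `B` at `b`. Over the hyperplane
orthogonal to `u`, the two boundaries are graphs of functions `f` and `g` with vanishing
differential at the base points `y₁`, `y₂`, and the boundary of the sum is the graph of `h(z) = max
(f(η₁) + g(η₂))` over `η₁ + η₂ = z`. The maximum is attained where `∇f(η₁) = ∇g(η₂)`. Both Hessians
are negative semidefinite, so their sum is invertible as soon as one of them is; then the inverse
function theorem makes `η₁`, `η₂` of class `C^{k-1,α}`. No derivative is lost in the end, because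
`∇h = ∇f ∘ η₁` is again `C^{k-1,α}`, so that `h` is `C^{k,α}` (`IsSupportedGraph.exists_add`). A
singular Hessian means zero Gaussian curvature, so `R(A) + B` is a `C^{k,α}` body whenever `R(Z_A)`
and `Z_B` are disjoint (`IsCkaConvexBody.image_isometry_add`).

It remains to see that this disjointness is generic. The Gauss map is `C¹` between manifolds of
equal dimension and `Z_B` consists of critical values, so by Sard's theorem and compactness it is
covered by finitely many closed sets with empty interior in the sphere
(`IsCkaConvexBody.exists_thin_cover`). For one vector `v` and one such set `T`, the rotations with
`R v ∉ T` form an open dense set (`dense_toIsometry_notMem`). With `Z_A` countable, Baire's theorem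
gives a dense `Gδ`; the case of countable `Z_B` follows by inverting `R`. -/

/-! ### Calculus of `C^{k,α}` maps and the inverse function theorem in that class. -/

section HolderCalculus

open Filter

/-- `f` is `α`-Hölder continuous on some neighbourhood of `x`. -/
def LocallyHolderAt {X Y : Type*} [PseudoEMetricSpace X] [PseudoEMetricSpace Y] (α : ℝ≥0)
    (f : X → Y) (x : X) : Prop :=
  ∃ V ∈ 𝓝 x, ∃ C : ℝ≥0, HolderOnWith C α f V

section Metric

variable {X Y Z : Type*} [PseudoEMetricSpace X] [PseudoEMetricSpace Y] [PseudoEMetricSpace Z]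
  {α : ℝ≥0} {x : X}

lemma LocallyHolderAt.congr {f g : X → Y} (h : LocallyHolderAt α f x) (hfg : f =ᶠ[𝓝 x] g) :
    LocallyHolderAt α g x := by
  obtain ⟨V, hV, C, hC⟩ := h
  refine ⟨V ∩ {y | f y = g y}, inter_mem hV hfg, C, ?_⟩
  rintro a ⟨ha, ha'⟩ b ⟨hb, hb'⟩
  rw [mem_ofPred_eq] at ha' hb'
  rw [← ha', ← hb']
  exact hC a ha b hb

lemma LocallyHolderAt.lipschitz_comp {g : Y → Z} {f : X → Y} {K : ℝ≥0} {t : Set Y}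
    (ht : t ∈ 𝓝 (f x)) (hg : LipschitzOnWith K g t) (hf : LocallyHolderAt α f x)
    (hc : ContinuousAt f x) : LocallyHolderAt α (g ∘ f) x := by
  obtain ⟨V, hV, C, hC⟩ := hf
  refine ⟨V ∩ f ⁻¹' t, inter_mem hV (hc ht), K * C ^ ((1 : ℝ≥0) : ℝ), ?_⟩
  have := (holderOnWith_one.2 hg).comp (hC.mono (inter_subset_left (t := f ⁻¹' t)))
    (fun y hy => hy.2)
  rwa [one_mul] at this

lemma LocallyHolderAt.comp_lipschitz {g : Y → Z} {f : X → Y} {K : ℝ≥0} {t : Set X}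
    (hg : LocallyHolderAt α g (f x)) (ht : t ∈ 𝓝 x) (hf : LipschitzOnWith K f t)
    (hc : ContinuousAt f x) : LocallyHolderAt α (g ∘ f) x := by
  obtain ⟨V, hV, C, hC⟩ := hg
  refine ⟨t ∩ f ⁻¹' V, inter_mem ht (hc hV), C * K ^ (α : ℝ), ?_⟩
  have := hC.comp ((holderOnWith_one.2 hf).mono (inter_subset_left (t := f ⁻¹' V)))
    (fun y hy => hy.2)
  rwa [mul_one] at this

lemma LocallyHolderAt.prodMk {f : X → Y} {g : X → Z} (hf : LocallyHolderAt α f x)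
    (hg : LocallyHolderAt α g x) : LocallyHolderAt α (fun y => (f y, g y)) x := by
  obtain ⟨V, hV, C, hC⟩ := hf
  obtain ⟨V', hV', C', hC'⟩ := hg
  refine ⟨V ∩ V', inter_mem hV hV', max C C', ?_⟩
  rintro a ⟨ha, ha'⟩ b ⟨hb, hb'⟩
  rw [Prod.edist_eq]
  refine max_le ((hC a ha b hb).trans ?_) ((hC' a ha' b hb').trans ?_) <;> gcongr <;> simp

lemma locallyHolderAt_isometry_comp_iff {e : Y → Z} (he : Isometry e) {f : X → Y} :
    LocallyHolderAt α (e ∘ f) x ↔ LocallyHolderAt α f x := by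
  simp only [LocallyHolderAt, HolderOnWith, Function.comp_apply, he.edist_eq]

end Metric

universe v

variable {E F G : Type v} [NormedAddCommGroup E] [NormedSpace ℝ E] [NormedAddCommGroup F]
  [NormedSpace ℝ F] [NormedAddCommGroup G] [NormedSpace ℝ G]

lemma LocallyHolderAt.of_contDiffAt {α : ℝ≥0} (hα : α ≤ 1) {f : E → F} {x : E}
    (hf : ContDiffAt ℝ 1 f x) : LocallyHolderAt α f x := by
  obtain ⟨K, t, ht, hK⟩ := hf.exists_lipschitzOnWith
  -- A Lipschitz map is `α`-Hölder only at bounded distances; the unit ball has diameter at most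
  -- `2`.
  refine ⟨t ∩ Metric.ball x 1, inter_mem ht (Metric.ball_mem_nhds x one_pos), _,
    HolderOnWith.of_le (r := 1) (C := K) (D := 2) ?_
      (holderOnWith_one.2 (hK.mono inter_subset_left)) hα⟩
  rintro a ⟨-, ha⟩ b ⟨-, hb⟩
  rw [edist_dist]
  apply ENNReal.ofReal_le_of_le_toReal
  have := dist_triangle_right a b x
  rw [Metric.mem_ball] at ha hb
  simp only [ENNReal.coe_ofNat, ENNReal.toReal_ofNat]
  linarith

/-- `f` is of class `C^{k,α}` at the point `x`. -/
def CkaAt (k : WithTop ℕ∞) (α : ℝ≥0) (f : E → F) (x : E) : Prop :=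
  ContDiffAt ℝ k f x ∧ ∀ m : ℕ, k = m → LocallyHolderAt α (iteratedFDeriv ℝ m f) x

lemma isCkaOn_iff_forall_ckaAt {k : WithTop ℕ∞} {α : ℝ≥0} {f : E → F} {U : Set E}
    (hU : IsOpen U) : IsCkaOn k α f U ↔ ∀ x ∈ U, CkaAt k α f x := by
  constructor
  · rintro ⟨h, h'⟩ x hx
    exact ⟨h.contDiffAt (hU.mem_nhds hx), fun m hm => h' m hm x hx⟩
  · intro h
    exact ⟨fun x hx => (h x hx).1.contDiffWithinAt, fun m hm x hx => (h x hx).2 m hm⟩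

namespace CkaAt

variable {k : WithTop ℕ∞} {α : ℝ≥0} {f : E → F} {x : E}

lemma congr {g : E → F} (h : CkaAt k α f x) (hfg : f =ᶠ[𝓝 x] g) : CkaAt k α g x :=
  ⟨h.1.congr_of_eventuallyEq hfg.symm, fun m hm => (h.2 m hm).congr (hfg.iteratedFDeriv ℝ m)⟩

lemma of_contDiffAt_succ (hα : α ≤ 1) {m : ℕ} (h : ContDiffAt ℝ (m + 1 : ℕ) f x) :
    CkaAt m α f x := by
  refine ⟨h.of_le (by exact_mod_cast m.le_succ), fun l hl => ?_⟩
  obtain rfl : m = l := by exact_mod_cast hl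
  apply LocallyHolderAt.of_contDiffAt hα
  apply h.iteratedFDeriv_right
  push_cast
  rw [add_comm]

lemma of_succ (hα : α ≤ 1) {m : ℕ} (h : CkaAt (m + 1 : ℕ) α f x) : CkaAt m α f x :=
  of_contDiffAt_succ hα h.1

lemma _root_.ckaAt_zero_iff :
    CkaAt (0 : ℕ) α f x ↔ ContDiffAt ℝ 0 f x ∧ LocallyHolderAt α f x := by
  have key : LocallyHolderAt α (iteratedFDeriv ℝ 0 f) x ↔ LocallyHolderAt α f x := by
    rw [iteratedFDeriv_zero_eq_comp]
    exact locallyHolderAt_isometry_comp_iff (LinearIsometryEquiv.isometry _)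
  constructor
  · exact fun h => ⟨h.1, key.1 (h.2 0 rfl)⟩
  · rintro ⟨h, h'⟩
    refine ⟨h, fun m hm => ?_⟩
    obtain rfl : 0 = m := by exact_mod_cast hm
    exact key.2 h'

/-- The currying that turns an `(m+1)`-st derivative of `f` into an `m`-th derivative of `fderiv ℝ
f` is an isometry, so it preserves Hölder conditions. The inductions on the order below rest on
this. -/
lemma _root_.ckaAt_succ_iff {m : ℕ} :
    CkaAt (m + 1 : ℕ) α f x ↔
      (∀ᶠ y in 𝓝 x, DifferentiableAt ℝ f y) ∧ CkaAt m α (fderiv ℝ f) x := by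
  have key : LocallyHolderAt α (iteratedFDeriv ℝ (m + 1) f) x ↔
      LocallyHolderAt α (iteratedFDeriv ℝ m (fderiv ℝ f)) x := by
    rw [show iteratedFDeriv ℝ (m + 1) f = (continuousMultilinearCurryRightEquiv' ℝ m E F).symm ∘
      iteratedFDeriv ℝ m (fderiv ℝ f) from funext fun y => iteratedFDeriv_succ_eq_comp_right]
    exact locallyHolderAt_isometry_comp_iff (LinearIsometryEquiv.isometry _)
  constructor
  · intro h
    have h1 := h.1
    refine ⟨?_, h1.fderiv_right (by push_cast; rfl), fun l hl => ?_⟩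
    · filter_upwards [h1.eventually (by simp)] with y hy
      exact hy.differentiableAt (by simp)
    · obtain rfl : m = l := by exact_mod_cast hl
      exact key.1 (h.2 _ rfl)
  · rintro ⟨h, h'⟩
    refine ⟨?_, fun l hl => ?_⟩
    · push_cast
      rw [contDiffAt_succ_iff_hasFDerivAt]
      exact ⟨fderiv ℝ f, ⟨_, h, fun y hy => hy.hasFDerivAt⟩, h'.1⟩
    · obtain rfl : m + 1 = l := by exact_mod_cast hl
      exact key.2 (h'.2 m rfl)

lemma continuousAt (h : CkaAt k α f x) : ContinuousAt f x := h.1.continuousAt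

lemma of_contDiffAt_omega (hα : α ≤ 1) (h : ContDiffAt ℝ ⊤ f x) : CkaAt k α f x := by
  refine ⟨h.of_le le_top, fun m hm => ?_⟩
  exact (of_contDiffAt_succ hα (h.of_le le_top)).2 m rfl

/-- The spaces are quantified inside the induction because passing to the derivative replaces `F` by
`E →L[ℝ] F`; a single universe keeps these in range. -/
lemma clm_comp_nat (m : ℕ) :
    ∀ {E F G : Type v} [NormedAddCommGroup E] [NormedSpace ℝ E] [NormedAddCommGroup F]
      [NormedSpace ℝ F] [NormedAddCommGroup G] [NormedSpace ℝ G] {f : E → F} {x : E}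
      (L : F →L[ℝ] G), CkaAt m α f x → CkaAt m α (fun y => L (f y)) x := by
  induction m with
  | zero =>
    intro E F G _ _ _ _ _ _ f x L h
    have h' := ckaAt_zero_iff.1 h
    refine ckaAt_zero_iff.2 ⟨L.contDiff.contDiffAt.comp x h'.1, ?_⟩
    exact LocallyHolderAt.lipschitz_comp (g := L) univ_mem L.lipschitz.lipschitzOnWith h'.2
      h.continuousAt
  | succ m ih =>
    intro E F G _ _ _ _ _ _ f x L h
    obtain ⟨h1, h2⟩ := ckaAt_succ_iff.1 h
    refine ckaAt_succ_iff.2 ⟨h1.mono fun y hy => L.differentiableAt.comp y hy, ?_⟩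
    refine (ih (ContinuousLinearMap.compL ℝ E F G L) h2).congr ?_
    filter_upwards [h1] with y hy
    exact (L.hasFDerivAt.comp y hy.hasFDerivAt).fderiv.symm

lemma prodMk_nat (m : ℕ) :
    ∀ {E F G : Type v} [NormedAddCommGroup E] [NormedSpace ℝ E] [NormedAddCommGroup F]
      [NormedSpace ℝ F] [NormedAddCommGroup G] [NormedSpace ℝ G] {f : E → F} {g : E → G} {x : E},
      CkaAt m α f x → CkaAt m α g x → CkaAt m α (fun y => (f y, g y)) x := by
  induction m with
  | zero =>
    intro E F G _ _ _ _ _ _ f g x h h'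
    have h1 := ckaAt_zero_iff.1 h
    have h2 := ckaAt_zero_iff.1 h'
    exact ckaAt_zero_iff.2 ⟨h1.1.prodMk h2.1, h1.2.prodMk h2.2⟩
  | succ m ih =>
    intro E F G _ _ _ _ _ _ f g x h h'
    obtain ⟨h1, h2⟩ := ckaAt_succ_iff.1 h
    obtain ⟨h1', h2'⟩ := ckaAt_succ_iff.1 h'
    refine ckaAt_succ_iff.2
      ⟨(h1.and h1').mono fun y hy => hy.1.prodMk hy.2, ?_⟩
    refine (clm_comp_nat m ((ContinuousLinearMap.prodₗᵢ (𝕜 := ℝ) (E := E) (F := F) (G := G)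
      ℝ).toContinuousLinearEquiv : _ →L[ℝ] _) (ih h2 h2')).congr ?_
    filter_upwards [h1, h1'] with y hy hy'
    exact (hy.hasFDerivAt.prodMk hy'.hasFDerivAt).fderiv.symm

/-- Differentiating an analytic outer map costs no regularity, so the induction closes. It comes
before the general chain rule, which needs it for the bilinear composition of derivatives. -/
lemma omega_comp_nat (hα : α ≤ 1) (m : ℕ) :
    ∀ {E F G : Type v} [NormedAddCommGroup E] [NormedSpace ℝ E] [NormedAddCommGroup F]
      [NormedSpace ℝ F] [NormedAddCommGroup G] [NormedSpace ℝ G] {f : E → F} {g : F → G} {x : E},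
      ContDiffAt ℝ ⊤ g (f x) → CkaAt m α f x → CkaAt m α (fun y => g (f y)) x := by
  induction m with
  | zero =>
    intro E F G _ _ _ _ _ _ f g x hg h
    have h' := ckaAt_zero_iff.1 h
    obtain ⟨K, t, ht, hK⟩ := (hg.of_le le_top : ContDiffAt ℝ 1 g (f x)).exists_lipschitzOnWith
    exact ckaAt_zero_iff.2 ⟨(hg.of_le le_top).comp x h'.1,
      LocallyHolderAt.lipschitz_comp ht hK h'.2 h.continuousAt⟩
  | succ m ih =>
    intro E F G _ _ _ _ _ _ f g x hg h
    obtain ⟨h1, h2⟩ := ckaAt_succ_iff.1 h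
    have hg1 : ∀ᶠ y in 𝓝 x, DifferentiableAt ℝ g (f y) :=
      h.continuousAt.eventually ((hg.eventually (by simp)).mono
        fun z hz => hz.differentiableAt (by simp))
    refine ckaAt_succ_iff.2 ⟨(h1.and hg1).mono fun y hy => hy.2.comp y hy.1, ?_⟩
    have hg' : CkaAt m α (fun y => fderiv ℝ g (f y)) x :=
      ih (hg.fderiv_right (m := ⊤) (by simp)) (h.of_succ hα)
    refine (ih (g := fun p : (F →L[ℝ] G) × (E →L[ℝ] F) => p.1.comp p.2)
      (contDiff_fst.clm_comp contDiff_snd).contDiffAt (prodMk_nat m hg' h2)).congr ?_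
    filter_upwards [h1, hg1] with y hy hy'
    exact (hy'.hasFDerivAt.comp y hy.hasFDerivAt).fderiv.symm

/-- The inner map is required to be `C¹` because at order zero the composite of two `α`-Hölder maps
is only `α²`-Hölder; a locally Lipschitz inner map keeps the exponent. -/
lemma comp_nat (hα : α ≤ 1) (m : ℕ) :
    ∀ {E F G : Type v} [NormedAddCommGroup E] [NormedSpace ℝ E] [NormedAddCommGroup F]
      [NormedSpace ℝ F] [NormedAddCommGroup G] [NormedSpace ℝ G] {f : E → F} {g : F → G} {x : E},
      CkaAt m α g (f x) → CkaAt m α f x → ContDiffAt ℝ 1 f x →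
        CkaAt m α (fun y => g (f y)) x := by
  induction m with
  | zero =>
    intro E F G _ _ _ _ _ _ f g x hg h hf1
    have h' := ckaAt_zero_iff.1 h
    have hg' := ckaAt_zero_iff.1 hg
    obtain ⟨K, t, ht, hK⟩ := hf1.exists_lipschitzOnWith
    exact ckaAt_zero_iff.2 ⟨hg'.1.comp x h'.1,
      LocallyHolderAt.comp_lipschitz hg'.2 ht hK h.continuousAt⟩
  | succ m ih =>
    intro E F G _ _ _ _ _ _ f g x hg h hf1
    obtain ⟨h1, h2⟩ := ckaAt_succ_iff.1 h
    obtain ⟨hg1, hg2⟩ := ckaAt_succ_iff.1 hg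
    have hg1 : ∀ᶠ y in 𝓝 x, DifferentiableAt ℝ g (f y) := h.continuousAt.eventually hg1
    refine ckaAt_succ_iff.2 ⟨(h1.and hg1).mono fun y hy => hy.2.comp y hy.1, ?_⟩
    have hg' : CkaAt m α (fun y => fderiv ℝ g (f y)) x := ih hg2 (h.of_succ hα) hf1
    refine (omega_comp_nat hα m (g := fun p : (F →L[ℝ] G) × (E →L[ℝ] F) => p.1.comp p.2)
      (contDiff_fst.clm_comp contDiff_snd).contDiffAt (prodMk_nat m hg' h2)).congr ?_
    filter_upwards [h1, hg1] with y hy hy'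
    exact (hy'.hasFDerivAt.comp y hy.hasFDerivAt).fderiv.symm

lemma prodMk {g : E → G} (hf : CkaAt k α f x) (hg : CkaAt k α g x) :
    CkaAt k α (fun y => (f y, g y)) x := by
  refine ⟨hf.1.prodMk hg.1, ?_⟩
  rintro m rfl
  exact (prodMk_nat m hf hg).2 m rfl

lemma omega_comp (hα : α ≤ 1) {g : F → G} (hg : ContDiffAt ℝ ⊤ g (f x)) (hf : CkaAt k α f x) :
    CkaAt k α (fun y => g (f y)) x := by
  refine ⟨(hg.of_le le_top).comp x hf.1, ?_⟩
  rintro m rfl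
  exact (omega_comp_nat hα m hg hf).2 m rfl

lemma comp (hα : α ≤ 1) {g : F → G} (hg : CkaAt k α g (f x)) (hf : CkaAt k α f x)
    (hf1 : ContDiffAt ℝ 1 f x) : CkaAt k α (fun y => g (f y)) x := by
  refine ⟨hg.1.comp x hf.1, ?_⟩
  rintro m rfl
  exact (comp_nat hα m hg hf hf1).2 m rfl

lemma add (hα : α ≤ 1) {g : E → F} (hf : CkaAt k α f x) (hg : CkaAt k α g x) :
    CkaAt k α (fun y => f y + g y) x :=
  omega_comp hα (g := fun p : F × F => p.1 + p.2) contDiff_add.contDiffAt (hf.prodMk hg)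

lemma sub (hα : α ≤ 1) {g : E → F} (hf : CkaAt k α f x) (hg : CkaAt k α g x) :
    CkaAt k α (fun y => f y - g y) x :=
  omega_comp hα (g := fun p : F × F => p.1 - p.2) (contDiff_fst.sub contDiff_snd).contDiffAt
    (hf.prodMk hg)

lemma fderiv_of_succ {j : WithTop ℕ∞} (h : CkaAt (j + 1) α f x) : CkaAt j α (fderiv ℝ f) x := by
  refine ⟨h.1.fderiv_right le_rfl, ?_⟩
  rintro m rfl
  exact (ckaAt_succ_iff.1 (by exact_mod_cast h)).2.2 m rfl

lemma pred (hα : α ≤ 1) {j : WithTop ℕ∞} (h : CkaAt (j + 1) α f x) : CkaAt j α f x := by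
  refine ⟨h.1.of_le le_self_add, ?_⟩
  rintro m rfl
  exact (of_succ hα (by exact_mod_cast h)).2 m rfl

/-- For `j = ∞` or `ω` one has `j + 1 = j`, and the first hypothesis is already the claim. -/
lemma succ_of_fderiv {j : WithTop ℕ∞} (h : CkaAt j α f x)
    (hd : ∀ᶠ y in 𝓝 x, DifferentiableAt ℝ f y) (h' : CkaAt j α (fderiv ℝ f) x) :
    CkaAt (j + 1) α f x := by
  by_cases hj : ∃ m : ℕ, j = m
  · obtain ⟨m, rfl⟩ := hj
    exact_mod_cast ckaAt_succ_iff.2 ⟨hd, h'⟩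
  · have : j + 1 = j := by
      induction j using WithTop.recTopCoe with
      | top => rfl
      | coe j =>
        induction j using ENat.recTopCoe with
        | top => rfl
        | coe m => exact absurd ⟨m, rfl⟩ hj
    rwa [this]

/-- A local inverse of a map of class `C^{k,α}` with `k ≥ 1` is of class `C^{k,α}`. -/
lemma symm [CompleteSpace E] (hα : α ≤ 1) (hk : 1 ≤ k) (e : OpenPartialHomeomorph E F) {y : F}
    (hy : y ∈ e.target) {e' : E ≃L[ℝ] F} (he' : HasFDerivAt e (e' : E →L[ℝ] F) (e.symm y))
    (he : CkaAt k α e (e.symm y)) : CkaAt k α e.symm y := by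
  have hs : ContDiffAt ℝ k e.symm y := e.contDiffAt_symm hy he' he.1
  refine ⟨hs, ?_⟩
  rintro m rfl
  -- Bootstrap: the derivative of the inverse is `(De ∘ e⁻¹)⁻¹`, so `C^{j,α}` regularity of `e⁻¹`
  -- passes to its derivative and gives order `j + 1`.
  have key : ∀ j ≤ m, CkaAt j α e.symm y := by
    intro j
    induction j with
    | zero =>
      intro _
      exact ckaAt_zero_iff.2 ⟨hs.of_le (by exact_mod_cast Nat.zero_le m),
        .of_contDiffAt hα (hs.of_le hk)⟩
    | succ j ih =>
      intro hj
      have ih := ih (by omega)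
      have hle : CkaAt (j + 1 : ℕ) α e (e.symm y) := by
        rcases hj.eq_or_lt with rfl | hlt
        · exact he
        · exact of_contDiffAt_succ hα (he.1.of_le (by exact_mod_cast hlt))
      have h1 : CkaAt j α (fun z => fderiv ℝ e (e.symm z)) y :=
        comp hα (ckaAt_succ_iff.1 hle).2 ih (hs.of_le hk)
      have h2 : CkaAt j α (fun z => (fderiv ℝ e (e.symm z)).inverse) y := by
        apply omega_comp hα _ h1
        rw [he'.fderiv]
        exact contDiffAt_map_inverse e'
      have hcs : ContinuousAt e.symm y := hs.continuousAt
      have hopen : ∀ᶠ z in 𝓝 y, fderiv ℝ e (e.symm z) ∈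
          range ((↑) : (E ≃L[ℝ] F) → (E →L[ℝ] F)) := by
        apply h1.continuousAt
        beta_reduce
        rw [he'.fderiv]
        exact ContinuousLinearEquiv.nhds e'
      have hde : ∀ᶠ z in 𝓝 y, DifferentiableAt ℝ e (e.symm z) :=
        hcs.eventually (ckaAt_succ_iff.1 hle).1
      have hder : ∀ᶠ z in 𝓝 y, HasFDerivAt e.symm (fderiv ℝ e (e.symm z)).inverse z := by
        filter_upwards [hopen, hde, e.open_target.mem_nhds hy] with z hz hz' hzt
        obtain ⟨L, hL⟩ := hz
        rw [← hL, ContinuousLinearMap.inverse_equiv]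
        apply e.hasFDerivAt_symm hzt
        rw [hL]
        exact hz'.hasFDerivAt
      exact ckaAt_succ_iff.2 ⟨hder.mono fun z hz => hz.differentiableAt,
        h2.congr (hder.mono fun z hz => hz.fderiv.symm)⟩
  exact (key m le_rfl).2 m rfl

end CkaAt

/-- Inverse function theorem in the class `C^{k,α}`, `k ≥ 1`. -/
theorem CkaAt.exists_local_inverse [CompleteSpace E] {k : WithTop ℕ∞} {α : ℝ≥0} (hα : α ≤ 1)
    (hk : 1 ≤ k) {f : E → F} {x : E} (hf : ∀ᶠ z in 𝓝 x, CkaAt k α f z) {f' : E ≃L[ℝ] F}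
    (hf' : HasFDerivAt f (f' : E →L[ℝ] F) x) :
    ∃ s : F → E, s (f x) = x ∧ (∀ᶠ y in 𝓝 (f x), f (s y) = y) ∧ (∀ᶠ z in 𝓝 x, s (f z) = z) ∧
      ∀ᶠ y in 𝓝 (f x), CkaAt k α s y := by
  have hk0 : k ≠ 0 := fun h => by simp [h] at hk
  have hx := hf.self_of_nhds
  let e := hx.1.toOpenPartialHomeomorph f hf' hk0
  have hxs : x ∈ e.source := hx.1.mem_toOpenPartialHomeomorph_source hf' hk0
  have hex : (e : E → F) = f := hx.1.toOpenPartialHomeomorph_coe hf' hk0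
  have hsx : e.symm (f x) = x := by rw [← hex]; exact e.left_inv hxs
  have hft : f x ∈ e.target := by rw [← hex]; exact e.map_source hxs
  have hcs : ContinuousAt e.symm (f x) := e.continuousAt_symm hft
  refine ⟨e.symm, hsx, ?_, ?_, ?_⟩
  · filter_upwards [e.open_target.mem_nhds hft] with y hy
    rw [← hex]
    exact e.right_inv hy
  · filter_upwards [e.open_source.mem_nhds hxs] with z hz
    rw [← hex]
    exact e.left_inv hz
  · have hopen : ∀ᶠ z in 𝓝 x, fderiv ℝ f z ∈ range ((↑) : (E ≃L[ℝ] F) → (E →L[ℝ] F)) := by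
      have : ContinuousAt (fderiv ℝ f) x :=
        ((hx.1.of_le hk).fderiv_right (m := 0) (by simp)).continuousAt
      apply this
      rw [hf'.fderiv]
      exact ContinuousLinearEquiv.nhds f'
    have hcs' : Tendsto e.symm (𝓝 (f x)) (𝓝 x) := by simpa only [ContinuousAt, hsx] using hcs
    filter_upwards [hcs'.eventually hf, hcs'.eventually hopen, e.open_target.mem_nhds hft]
      with y h1 h2 h3
    obtain ⟨L, hL⟩ := h2
    refine CkaAt.symm hα hk e h3 (e' := L) ?_ ?_
    · rw [hL, hex]
      exact (h1.1.differentiableAt hk0).hasFDerivAt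
    · rw [hex]
      exact h1

end HolderCalculus

/-! ### Boundaries of convex bodies as graphs over tangent hyperplanes. -/

section ConvexHypersurfaces

open Filter

/-- A linear functional is its own derivative, so an interior maximum would make it zero. -/
lemma ContinuousLinearMap.lt_of_forall_le_of_mem_interior {E : Type*} [NormedAddCommGroup E]
    [NormedSpace ℝ E] {C : Set E} {l : E →L[ℝ] ℝ} (hl : l ≠ 0) {r : ℝ} (h : ∀ a ∈ C, l a ≤ r)
    {c : E} (hc : c ∈ interior C) : l c < r := by
  refine lt_of_le_of_ne (h c (interior_subset hc)) fun heq => hl ?_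
  refine IsLocalMax.hasFDerivAt_eq_zero (f := l) (a := c) ?_ l.hasFDerivAt
  filter_upwards [mem_interior_iff_mem_nhds.1 hc] with a ha
  rw [heq]
  exact h a ha

lemma ContinuousLinearMap.exists_equiv_of_injective {E F : Type*} [NormedAddCommGroup E]
    [NormedSpace ℝ E] [FiniteDimensional ℝ E] [NormedAddCommGroup F] [NormedSpace ℝ F]
    [FiniteDimensional ℝ F] (hEF : Module.finrank ℝ E = Module.finrank ℝ F) (A : E →L[ℝ] F)
    (hA : ∀ x, A x = 0 → x = 0) : ∃ A' : E ≃L[ℝ] F, (A' : E →L[ℝ] F) = A := by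
  have hinj : Function.Injective (A : E →ₗ[ℝ] F) :=
    (injective_iff_map_eq_zero (A : E →ₗ[ℝ] F)).2 hA
  refine ⟨(LinearEquiv.ofInjectiveOfFinrankEq _ hinj hEF).toContinuousLinearEquiv, ?_⟩
  ext x
  rfl

variable {E : Type} [NormedAddCommGroup E] [InnerProductSpace ℝ E]
variable {W : Type} [NormedAddCommGroup W] [InnerProductSpace ℝ W]

/-- `ι` identifies `W` with the hyperplane orthogonal to the unit vector `u`, and `P` is the
corresponding orthogonal projection. -/
structure IsFrame (ι : W →ₗᵢ[ℝ] E) (P : E →L[ℝ] W) (u : E) : Prop where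
  norm_eq : ‖u‖ = 1
  inner_eq : ∀ w, ⟪u, ι w⟫_ℝ = 0
  proj_ι : ∀ w, P (ι w) = w
  proj_u : P u = 0
  decomp : ∀ x, ι (P x) + ⟪u, x⟫_ℝ • u = x

namespace IsFrame

variable {ι : W →ₗᵢ[ℝ] E} {P : E →L[ℝ] W} {u : E}

lemma inner_self (h : IsFrame ι P u) : ⟪u, u⟫_ℝ = 1 := by
  rw [real_inner_self_eq_norm_sq, h.norm_eq, one_pow]

lemma proj_graph (h : IsFrame ι P u) (y : W) (t : ℝ) : P (ι y + t • u) = y := by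
  simp [h.proj_ι, h.proj_u]

lemma inner_graph (h : IsFrame ι P u) (y : W) (t : ℝ) : ⟪u, ι y + t • u⟫_ℝ = t := by
  simp [inner_add_right, h.inner_eq, inner_smul_right, h.norm_eq]

lemma orthogonal_span_singleton {e : E} (he : ‖e‖ = 1) :
    IsFrame ((ℝ ∙ e)ᗮ).subtypeₗᵢ ((ℝ ∙ e)ᗮ.orthogonalProjectionOnto) e where
  norm_eq := he
  inner_eq w := Submodule.mem_orthogonal_singleton_iff_inner_right.1 w.2
  proj_ι w := Submodule.orthogonalProjectionOnto_mem_subspace_eq_self w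
  proj_u := by
    rw [Submodule.orthogonalProjectionOnto_eq_zero_iff]
    exact Submodule.le_orthogonal_orthogonal _ (Submodule.mem_span_singleton_self e)
  decomp x := by
    have h1 := Submodule.starProjection_unit_singleton ℝ he x
    have h2 := Submodule.starProjection_add_starProjection_orthogonal (K := ℝ ∙ e) x
    rw [← h1, add_comm]
    exact h2

lemma comp_isometry (h : IsFrame ι P u) {E' : Type} [NormedAddCommGroup E']
    [InnerProductSpace ℝ E'] (R : E ≃ₗᵢ[ℝ] E') :
    IsFrame (R.toLinearIsometry.comp ι) (P ∘L (R.symm.toContinuousLinearEquiv : E' →L[ℝ] E))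
      (R u) where
  norm_eq := by rw [R.norm_map, h.norm_eq]
  inner_eq w := by simp [h.inner_eq]
  proj_ι w := by simp [h.proj_ι]
  proj_u := by simp [h.proj_u]
  decomp x := by
    have := congrArg R (h.decomp (R.symm x))
    rw [map_add, map_smul, ← R.inner_map_map, R.apply_symm_apply] at this
    exact this

end IsFrame

/-- First order condition for a linear functional that attains its maximum over `C` at a point of a
graph contained in `C`. -/
lemma inner_tangent_eq_zero {C : Set E} {ι : W →ₗᵢ[ℝ] E} {e : E} {f : W → ℝ} {y₀ : W}
    (hmem : ∀ᶠ y in 𝓝 y₀, ι y + f y • e ∈ C) (hf : DifferentiableAt ℝ f y₀) {n : E}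
    (hn : ∀ a ∈ C, ⟪n, a⟫_ℝ ≤ ⟪n, ι y₀ + f y₀ • e⟫_ℝ) (w : W) :
    ⟪n, ι w⟫_ℝ + fderiv ℝ f y₀ w * ⟪n, e⟫_ℝ = 0 := by
  have hd : HasFDerivAt (fun y => ⟪n, ι y + f y • e⟫_ℝ)
      ((innerSL ℝ n) ∘L (ι.toContinuousLinearMap + (fderiv ℝ f y₀).smulRight e)) y₀ :=
    (innerSL ℝ n).hasFDerivAt.comp y₀
      (ι.toContinuousLinearMap.hasFDerivAt.add (hf.hasFDerivAt.smul_const e))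
  have hmax : IsLocalMax (fun y => ⟪n, ι y + f y • e⟫_ℝ) y₀ := by
    filter_upwards [hmem] with y hy using hn _ hy
  have := congrArg (fun L => L w) (hmax.hasFDerivAt_eq_zero hd)
  simpa [inner_add_right, inner_smul_right] using this

variable {k : WithTop ℕ∞} {α : ℝ≥0} {C : Set E}

lemma exists_ne_zero_inner_le [CompleteSpace E] (hC : Convex ℝ C) (hne : (interior C).Nonempty)
    {x : E} (hx : x ∈ frontier C) : ∃ n : E, n ≠ 0 ∧ ∀ a ∈ C, ⟪n, a⟫_ℝ ≤ ⟪n, x⟫_ℝ := by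
  obtain ⟨l, hl, hl'⟩ := geometric_hahn_banach_of_nonempty_interior_point hC hx.2 hne
  refine ⟨(InnerProductSpace.toDual ℝ E).symm l, by simpa using hl, fun a ha => ?_⟩
  simpa using hl' a ha

lemma inner_lt_of_mem_interior {n x c : E} (hn : n ≠ 0) (h : ∀ a ∈ C, ⟪n, a⟫_ℝ ≤ ⟪n, x⟫_ℝ)
    (hc : c ∈ interior C) : ⟪n, c⟫_ℝ < ⟪n, x⟫_ℝ := by
  refine ContinuousLinearMap.lt_of_forall_le_of_mem_interior (l := innerSL ℝ n) ?_ h hc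
  intro h0
  apply hn
  have := congrArg (fun L => L n) h0
  simpa using this

/-- Near a boundary point, the boundary of a convex body of class `C^{k,α}` is the zero set of a
function of class `C^{k,α}` whose differential is an outer normal functional. -/
theorem IsCkaConvexBody.exists_defining_function [CompleteSpace E] (hk : 1 ≤ k) (hα : α ≤ 1)
    (hC : IsCkaConvexBody k α C) {p : E} (hp : p ∈ frontier C) :
    ∃ φ : E → ℝ, (∀ᶠ x in 𝓝 p, CkaAt k α φ x) ∧ (∀ᶠ x in 𝓝 p, x ∈ frontier C ↔ φ x = 0) ∧
      (∀ᶠ x in 𝓝 p, x ∈ frontier C → ∀ a ∈ C, fderiv ℝ φ x a ≤ fderiv ℝ φ x x) ∧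
      fderiv ℝ φ p ≠ 0 ∧
      ∀ n : E, (∀ a ∈ C, ⟪n, a⟫_ℝ ≤ ⟪n, p⟫_ℝ) → ∃ c : ℝ, ∀ v, ⟪n, v⟫_ℝ = c * fderiv ℝ φ p v := by
  obtain ⟨e, he, f, V, U, hV, hpV, hf, hU, hpU, hgraph⟩ := hC.boundary p hp
  obtain ⟨c₀, hc₀⟩ := hC.nonempty_interior
  set P := (ℝ ∙ e)ᗮ.orthogonalProjectionOnto with hP
  have hfr : IsFrame ((ℝ ∙ e)ᗮ).subtypeₗᵢ P e := .orthogonal_span_singleton he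
  set ι := ((ℝ ∙ e)ᗮ).subtypeₗᵢ
  have hk0 : k ≠ 0 := fun h => by simp [h] at hk
  have hf' := (isCkaOn_iff_forall_ckaAt hV).1 hf
  let φ : E → ℝ := fun x => ⟪e, x⟫_ℝ - f (P x)
  have hφ : ∀ x, P x ∈ V → CkaAt k α φ x := by
    intro x hx
    refine CkaAt.sub hα (CkaAt.of_contDiffAt_omega hα (innerSL ℝ e).contDiff.contDiffAt) ?_
    exact CkaAt.comp hα (hf' _ hx) (.of_contDiffAt_omega hα P.contDiff.contDiffAt)
      P.contDiff.contDiffAt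
  have hφ' : ∀ x, P x ∈ V → ∀ v, fderiv ℝ φ x v = ⟪e, v⟫_ℝ - fderiv ℝ f (P x) (P v) := by
    intro x hx v
    have h1 : HasFDerivAt φ (innerSL ℝ e - (fderiv ℝ f (P x)) ∘L P) x :=
      (innerSL ℝ e).hasFDerivAt.sub
        (((hf' _ hx).1.differentiableAt hk0).hasFDerivAt.comp x P.hasFDerivAt)
    rw [h1.fderiv]
    simp
  have hVnhds : ∀ᶠ x in 𝓝 p, P x ∈ V := P.continuous.continuousAt (hV.mem_nhds hpV)
  -- The first order condition along the graph shows that every outer normal functional is a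
  -- multiple of the differential of `φ`; only the sign remains open.
  have hmult : ∀ x ∈ U, P x ∈ V → x ∈ frontier C → ∀ n : E, (∀ a ∈ C, ⟪n, a⟫_ℝ ≤ ⟪n, x⟫_ℝ) →
      ∀ v, ⟪n, v⟫_ℝ = ⟪n, e⟫_ℝ * fderiv ℝ φ x v := by
    intro x hxU hxV hx n hn v
    have hxe : ι (P x) + f (P x) • e = x := by
      rw [← (hgraph x hxU).1 hx]
      exact hfr.decomp x
    have hfd := (hf' _ hxV).1.differentiableAt hk0
    have hmem : ∀ᶠ y in 𝓝 (P x), ι y + f y • e ∈ C := by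
      have hc : ContinuousAt (fun y => ι y + f y • e) (P x) :=
        ι.continuous.continuousAt.add (hfd.continuousAt.smul continuousAt_const)
      have hUx : U ∈ 𝓝 (ι (P x) + f (P x) • e) := by
        rw [hxe]
        exact hU.mem_nhds hxU
      filter_upwards [hc hUx] with y hy
      apply hC.isCompact.isClosed.frontier_subset
      rw [hgraph _ hy, hfr.inner_graph]
      exact congrArg f (hfr.proj_graph y (f y)).symm
    have h0 := inner_tangent_eq_zero (n := n) hmem hfd (by rwa [hxe]) (P v)
    rw [hφ' x hxV]
    conv_lhs => rw [← hfr.decomp v, inner_add_right, inner_smul_right]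
    linear_combination h0
  -- The factor `σ` orients `φ`: its differential must decrease from `p` towards the interior point
  -- `c₀`. By continuity this sign persists at nearby boundary points.
  obtain ⟨σ, hσ0, hσ⟩ : ∃ σ : ℝ, σ ≠ 0 ∧ σ * fderiv ℝ φ p (c₀ - p) < 0 := by
    obtain ⟨n, hn0, hn⟩ := exists_ne_zero_inner_le hC.convex ⟨c₀, hc₀⟩ hp
    have h1 := inner_lt_of_mem_interior hn0 hn hc₀
    have h2 := hmult p hpU hpV hp n hn (c₀ - p)
    rw [inner_sub_right] at h2
    refine ⟨⟪n, e⟫_ℝ, fun h => ?_, by linarith⟩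
    rw [h] at h2
    linarith
  have hdσ : ∀ x, P x ∈ V → ∀ v, fderiv ℝ (fun x => σ * φ x) x v = σ * fderiv ℝ φ x v := by
    intro x hx v
    rw [fderiv_const_mul ((hφ x hx).1.differentiableAt hk0)]
    rfl
  refine ⟨fun x => σ * φ x, ?_, ?_, ?_, ?_, ?_⟩
  · filter_upwards [hVnhds] with x hx
    exact CkaAt.omega_comp hα (g := fun t => σ * t) (contDiff_const.mul contDiff_id).contDiffAt
      (hφ x hx)
  · filter_upwards [hU.mem_nhds hpU] with x hx
    rw [hgraph x hx, mul_eq_zero, or_iff_right hσ0, sub_eq_zero]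
  · have hcont : ContinuousAt (fun x => σ * fderiv ℝ φ x (c₀ - x)) p := by
      have h1 : ContinuousAt (fderiv ℝ φ) p :=
        (((hφ p hpV).1.of_le hk).fderiv_right (m := 0) (by simp)).continuousAt
      exact continuousAt_const.mul (h1.clm_apply (continuousAt_const.sub continuousAt_id))
    filter_upwards [hU.mem_nhds hpU, hVnhds, hcont.eventually_lt_const hσ] with x hxU hxV hlt hx a ha
    obtain ⟨n, hn0, hn⟩ := exists_ne_zero_inner_le hC.convex ⟨c₀, hc₀⟩ hx
    have h1 := inner_lt_of_mem_interior hn0 hn hc₀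
    have h2 := hmult x hxU hxV hx n hn (c₀ - x)
    have h3 := hmult x hxU hxV hx n hn (a - x)
    have h4 := hn a ha
    rw [inner_sub_right] at h2 h3
    rw [hdσ x hxV, hdσ x hxV]
    rw [map_sub] at h2 h3 hlt
    set d := fderiv ℝ φ x
    set s := ⟪n, e⟫_ℝ
    have h5 : s * (d c₀ - d x) < 0 := by linarith
    have h6 : s * (d a - d x) ≤ 0 := by linarith
    -- Both `σ` and `s` make `d c₀ - d x` negative, so they have the same sign.
    have h7 : 0 < σ * s := by
      have := mul_pos_of_neg_of_neg hlt h5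
      by_contra hcon
      nlinarith [mul_nonneg (neg_nonneg.2 (not_lt.1 hcon)) (sq_nonneg (d c₀ - d x))]
    by_contra hcon
    have h8 : 0 < σ * (d a - d x) := by linarith
    have h9 : 0 < s * s := by
      apply mul_self_pos.2
      rintro h0
      simp [h0] at h7
    nlinarith [mul_pos h8 h9, mul_nonneg h7.le (neg_nonneg.2 h6)]
  · intro h0
    have := hdσ p hpV e
    rw [h0, hφ' p hpV, hfr.proj_u, hfr.inner_self] at this
    simp at this
    exact hσ0 this.symm
  · intro n hn
    refine ⟨⟪n, e⟫_ℝ / σ, fun v => ?_⟩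
    rw [hmult p hpU hpV hp n hn v, hdσ p hpV]
    field_simp

/-- Over the open set `V`, the graph of `f` in the frame `(ι, u)` lies in `C`, with outer normals
given by the differential of `f`. -/
structure IsSupportedGraph (C : Set E) (ι : W →ₗᵢ[ℝ] E) (P : E →L[ℝ] W) (u : E) (f : W → ℝ)
    (V : Set W) : Prop where
  isOpen : IsOpen V
  mem : ∀ y ∈ V, ι y + f y • u ∈ C
  normal : ∀ y ∈ V, ∀ a ∈ C, ⟪u, a⟫_ℝ - fderiv ℝ f y (P a) ≤ f y - fderiv ℝ f y y

/-- Near a boundary point, a convex body of class `C^{k,α}` is bounded by the graph of a function of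
class `C^{k,α}` over its tangent hyperplane. -/
theorem IsCkaConvexBody.exists_tangent_graph [CompleteSpace E] [FiniteDimensional ℝ W]
    (hk : 1 ≤ k) (hα : α ≤ 1) (hC : IsCkaConvexBody k α C) {p : E} (hp : p ∈ frontier C) {u : E}
    (hu : ∀ a ∈ C, ⟪u, a⟫_ℝ ≤ ⟪u, p⟫_ℝ) {ι : W →ₗᵢ[ℝ] E} {P : E →L[ℝ] W} (hfr : IsFrame ι P u) :
    ∃ (f : W → ℝ) (V : Set W), IsSupportedGraph C ι P u f V ∧ (∀ y ∈ V, CkaAt k α f y) ∧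
      P p ∈ V ∧ ι (P p) + f (P p) • u = p ∧ fderiv ℝ f (P p) = 0 ∧
      ∀ᶠ x in 𝓝 p, x ∈ frontier C → P x ∈ V ∧ ι (P x) + f (P x) • u = x := by
  obtain ⟨φ, hφ, hzero, hnormal, hφp, hmult⟩ := hC.exists_defining_function hk hα hp
  obtain ⟨c₀, hc₀⟩ := hC.nonempty_interior
  obtain ⟨c, hc⟩ := hmult u hu
  have hk0 : k ≠ 0 := fun h => by simp [h] at hk
  have hcu : c * fderiv ℝ φ p u = 1 := by rw [← hc, hfr.inner_self]
  have hc0 : c ≠ 0 := left_ne_zero_of_mul_eq_one hcu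
  have hu0 : u ≠ 0 := fun h => by simpa [h] using hfr.norm_eq
  have hpos : 0 < fderiv ℝ φ p u := by
    have h1 := inner_lt_of_mem_interior hu0 hu hc₀
    rw [hc, hc] at h1
    have h2 := ContinuousLinearMap.lt_of_forall_le_of_mem_interior hφp
      (hnormal.self_of_nhds hp) hc₀
    have h3 : 0 < c := by
      by_contra hcon
      nlinarith
    by_contra hcon
    nlinarith
  let L : W × ℝ →L[ℝ] E := ι.toContinuousLinearMap.coprod (ContinuousLinearMap.toSpanSingleton ℝ u)
  have hL : ∀ y t, L (y, t) = ι y + t • u := fun y t => by simp [L]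
  have hLp : L (P p, ⟪u, p⟫_ℝ) = p := by rw [hL, hfr.decomp]
  -- Implicit function theorem: since `dφ_p(u) > 0`, the map `(y, t) ↦ (y, φ(ι y + t u))` is locally
  -- invertible, and `f(y)` is the height component of the preimage of `(y, 0)`.
  let Φ : W × ℝ → W × ℝ := fun z => (z.1, φ (L z))
  have hφd : DifferentiableAt ℝ φ p := hφ.self_of_nhds.1.differentiableAt hk0
  have hLt : Tendsto L (𝓝 (P p, ⟪u, p⟫_ℝ)) (𝓝 p) := by
    simpa only [hLp] using L.continuous.tendsto (P p, ⟪u, p⟫_ℝ)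
  have hΦ : ∀ᶠ z in 𝓝 (P p, ⟪u, p⟫_ℝ), CkaAt k α Φ z := by
    filter_upwards [hLt.eventually hφ] with z hz
    exact CkaAt.prodMk (.of_contDiffAt_omega hα contDiff_fst.contDiffAt)
      (CkaAt.comp hα hz (.of_contDiffAt_omega hα L.contDiff.contDiffAt) L.contDiff.contDiffAt)
  have hder : HasFDerivAt Φ ((ContinuousLinearMap.fst ℝ W ℝ).prod ((fderiv ℝ φ p) ∘L L))
      (P p, ⟪u, p⟫_ℝ) := by
    refine (ContinuousLinearMap.fst ℝ W ℝ).hasFDerivAt.prodMk ?_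
    refine HasFDerivAt.comp (g := φ) _ ?_ L.hasFDerivAt
    rw [hLp]
    exact hφd.hasFDerivAt
  obtain ⟨A, hA⟩ := ContinuousLinearMap.exists_equiv_of_injective rfl _ (fun z hz => by
    obtain ⟨w, s⟩ := z
    have h1 : w = 0 := congrArg Prod.fst hz
    have h2 : fderiv ℝ φ p (L (w, s)) = 0 := congrArg Prod.snd hz
    rw [hL, h1] at h2
    simp [hpos.ne'] at h2
    rw [h1, h2]
    rfl :
    ∀ z, ((ContinuousLinearMap.fst ℝ W ℝ).prod ((fderiv ℝ φ p) ∘L L)) z = 0 → z = 0)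
  rw [← hA] at hder
  have := FiniteDimensional.complete ℝ W
  obtain ⟨s, hs0, hs1, hs2, hs3⟩ := CkaAt.exists_local_inverse hα hk hΦ hder
  have hφp0 : φ p = 0 := hzero.self_of_nhds.1 hp
  have hΦp : Φ (P p, ⟪u, p⟫_ℝ) = (P p, 0) := by
    simp only [Φ, hLp, hφp0]
  rw [hΦp] at hs0 hs1 hs3
  let f : W → ℝ := fun y => (s (y, 0)).2
  have hin : Continuous (fun y : W => (y, (0 : ℝ))) := by fun_prop
  have hinA : ContDiff ℝ ⊤ (fun y : W => (y, (0 : ℝ))) := contDiff_id.prodMk contDiff_const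
  have hin1 : Tendsto (fun y : W => (y, (0 : ℝ))) (𝓝 (P p)) (𝓝 (P p, 0)) := hin.tendsto _
  have hfC : ∀ᶠ y in 𝓝 (P p), CkaAt k α f y := by
    filter_upwards [hin1.eventually hs3] with y hy
    exact CkaAt.omega_comp hα (g := Prod.snd) contDiff_snd.contDiffAt
      (CkaAt.comp hα (f := fun y : W => (y, (0 : ℝ))) hy
        (.of_contDiffAt_omega hα hinA.contDiffAt) (hinA.contDiffAt.of_le le_top))
  have hf0 : f (P p) = ⟪u, p⟫_ℝ := by simp [f, hs0]
  have hfsol : ∀ᶠ y in 𝓝 (P p), φ (ι y + f y • u) = 0 := by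
    filter_upwards [hin1.eventually hs1] with y hy
    have h1 : (s (y, 0)).1 = y := congrArg Prod.fst hy
    have h2 : φ (L (s (y, 0))) = 0 := congrArg Prod.snd hy
    rwa [show s (y, 0) = (y, f y) from Prod.ext h1 rfl, hL] at h2
  have hγp : ι (P p) + f (P p) • u = p := by rw [hf0, hfr.decomp]
  have hγ : Tendsto (fun y => ι y + f y • u) (𝓝 (P p)) (𝓝 p) := by
    have hc : ContinuousAt (fun y => ι y + f y • u) (P p) :=
      ι.continuous.continuousAt.add
        (hfC.self_of_nhds.continuousAt.smul continuousAt_const)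
    simpa only [ContinuousAt, hγp] using hc
  have hφpos : ∀ᶠ x in 𝓝 p, 0 < fderiv ℝ φ x u := by
    have h1 : ContinuousAt (fderiv ℝ φ) p :=
      ((hφ.self_of_nhds.1.of_le hk).fderiv_right (m := 0) (by simp)).continuousAt
    exact (h1.clm_apply continuousAt_const).eventually_const_lt hpos
  -- Differentiating `φ = 0` along the graph expresses the differential of `φ` through that of `f`;
  -- the positive factor `dφ(u)` then carries the outer normal inequality over to `f`.
  have htan : ∀ y, (∀ᶠ z in 𝓝 y, φ (ι z + f z • u) = 0) → CkaAt k α f y →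
      CkaAt k α φ (ι y + f y • u) → ∀ v, fderiv ℝ φ (ι y + f y • u) v =
        fderiv ℝ φ (ι y + f y • u) u * (⟪u, v⟫_ℝ - fderiv ℝ f y (P v)) := by
    intro y hy hfy hφy v
    have h1 : HasFDerivAt (fun z => φ (ι z + f z • u)) (fderiv ℝ φ (ι y + f y • u) ∘L
        (ι.toContinuousLinearMap + (fderiv ℝ f y).smulRight u)) y :=
      (hφy.1.differentiableAt hk0).hasFDerivAt.comp y
        (ι.toContinuousLinearMap.hasFDerivAt.add
          ((hfy.1.differentiableAt hk0).hasFDerivAt.smul_const u))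
    have h2 : HasFDerivAt (fun z => φ (ι z + f z • u)) (0 : W →L[ℝ] ℝ) y :=
      (hasFDerivAt_const (0 : ℝ) y).congr_of_eventuallyEq hy
    have h3 := congrArg (fun M => M (P v)) (h1.unique h2)
    simp only [ContinuousLinearMap.comp_apply, add_apply, map_add,
      ContinuousLinearMap.smulRight_apply, map_smul, smul_eq_mul,
      zero_apply, LinearIsometry.coe_toContinuousLinearMap] at h3
    conv_lhs => rw [← hfr.decomp v, map_add, map_smul, smul_eq_mul]
    linear_combination h3
  have hall := hfC.and ((eventually_eventually_nhds.2 hfsol).and ((hγ.eventually hφ).and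
    ((hγ.eventually hzero).and ((hγ.eventually hnormal).and (hγ.eventually hφpos)))))
  obtain ⟨V, hVsub, hVo, hpV⟩ := mem_nhds_iff.1 hall
  refine ⟨f, V, ⟨hVo, fun y hy => ?_, fun y hy a ha => ?_⟩, fun y hy => (hVsub hy).1, hpV, hγp,
    ?_, ?_⟩
  · obtain ⟨-, h2, -, h4, -, -⟩ := hVsub hy
    exact hC.isCompact.isClosed.frontier_subset (h4.2 h2.self_of_nhds)
  · obtain ⟨h1, h2, h3, h4, h5, h6⟩ := hVsub hy
    have h7 := h5 (h4.2 h2.self_of_nhds) a ha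
    rw [htan y h2 h1 h3 a, htan y h2 h1 h3 (ι y + f y • u), hfr.inner_graph, hfr.proj_graph] at h7
    exact le_of_mul_le_mul_left h7 h6
  · obtain ⟨h1, h2, h3, -⟩ := hVsub hpV
    ext w
    have h4 := htan _ h2 h1 h3 (ι w)
    rw [hγp, hfr.inner_eq, hfr.proj_ι] at h4
    have h5 : fderiv ℝ φ p (ι w) = 0 := by
      have := hc (ι w)
      rw [hfr.inner_eq] at this
      simpa [hc0] using this.symm
    rw [h5] at h4
    simpa [hpos.ne'] using h4.symm
  -- The left inverse property gives uniqueness: every boundary point near `p` lies on the graph.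
  · have hcoord : Tendsto (fun x => (P x, ⟪u, x⟫_ℝ)) (𝓝 p) (𝓝 (P p, ⟪u, p⟫_ℝ)) :=
      (P.continuous.prodMk (continuous_const.inner continuous_id)).tendsto p
    filter_upwards [hcoord.eventually hs2, hzero, P.continuous.continuousAt (hVo.mem_nhds hpV)]
      with x h1 h2 h3 hx
    refine ⟨h3, ?_⟩
    have h4 : Φ (P x, ⟪u, x⟫_ℝ) = (P x, 0) := by
      simp only [Φ]
      rw [hL, hfr.decomp, h2.1 hx]
    rw [h4] at h1
    have h5 : f (P x) = ⟪u, x⟫_ℝ := congrArg Prod.snd h1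
    rw [h5, hfr.decomp]

end ConvexHypersurfaces

/-! ### The Gauss map in graph coordinates, and Sard's theorem for flat points. -/

section GaussMap

open Filter

variable {E : Type} [NormedAddCommGroup E] [InnerProductSpace ℝ E]
variable {W : Type} [NormedAddCommGroup W] [InnerProductSpace ℝ W]

/-- The Riesz representation of functionals, as a real linear map. -/
noncomputable def rieszRepresentative (W : Type) [NormedAddCommGroup W] [InnerProductSpace ℝ W]
    [CompleteSpace W] : (W →L[ℝ] ℝ) →L[ℝ] W where
  toFun l := (InnerProductSpace.toDual ℝ W).symm l
  map_add' := map_add _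
  map_smul' c l := by simp
  cont := (InnerProductSpace.toDual ℝ W).symm.continuous

section Gradient

variable [CompleteSpace W]

lemma inner_rieszRepresentative (l : W →L[ℝ] ℝ) (w : W) : ⟪rieszRepresentative W l, w⟫_ℝ = l w :=
  InnerProductSpace.toDual_symm_apply

lemma gradient_eq_rieszRepresentative (f : W → ℝ) :
    gradient f = fun y => rieszRepresentative W (fderiv ℝ f y) := rfl

lemma inner_gradient (f : W → ℝ) (y w : W) : ⟪gradient f y, w⟫_ℝ = fderiv ℝ f y w :=
  inner_rieszRepresentative _ _

lemma CkaAt.gradient_of_succ {j : WithTop ℕ∞} {α : ℝ≥0} (hα : α ≤ 1) {f : W → ℝ} {y : W}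
    (h : CkaAt (j + 1) α f y) : CkaAt j α (gradient f) y :=
  omega_comp hα (f := fderiv ℝ f) (g := rieszRepresentative W)
    (rieszRepresentative W).contDiff.contDiffAt h.fderiv_of_succ

lemma ContDiffAt.gradient_of_two {f : W → ℝ} {y : W} (h : ContDiffAt ℝ 2 f y) :
    ContDiffAt ℝ 1 (gradient f) y :=
  (rieszRepresentative W).contDiff.contDiffAt.comp y
    (h.fderiv_right (m := 1) (by norm_num))

lemma inner_fderiv_gradient {f : W → ℝ} {y : W} (h : ContDiffAt ℝ 2 f y) (v w : W) :
    ⟪fderiv ℝ (gradient f) y v, w⟫_ℝ = fderiv ℝ (fderiv ℝ f) y v w := by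
  have h1 : DifferentiableAt ℝ (fderiv ℝ f) y :=
    (h.fderiv_right (m := 1) (by norm_num)).differentiableAt (by norm_num)
  have h2 : HasFDerivAt (gradient f) (rieszRepresentative W ∘L fderiv ℝ (fderiv ℝ f) y) y :=
    (rieszRepresentative W).hasFDerivAt.comp y h1.hasFDerivAt
  rw [h2.fderiv]
  exact inner_rieszRepresentative _ _

end Gradient

/-- A closed set whose complement meets the unit sphere in a dense set. -/
def IsClosedThinInSphere (T : Set E) : Prop :=
  IsClosed T ∧ ∀ v₀ : E, ‖v₀‖ = 1 → ∀ ε > 0, ∃ v : E, ‖v‖ = 1 ∧ dist v v₀ < ε ∧ v ∉ T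

lemma differentiableAt_inv_norm_smul {x : E} (hx : x ≠ 0) :
    DifferentiableAt ℝ (fun z : E => ‖z‖⁻¹ • z) x :=
  ((contDiffAt_norm ℝ hx (n := 1)).differentiableAt (by norm_num)).inv (norm_ne_zero_iff.2 hx)
    |>.smul differentiableAt_id

variable {C : Set E} {ι : W →ₗᵢ[ℝ] E} {P : E →L[ℝ] W} {u : E} {f : W → ℝ} {V : Set W} {y : W}

namespace IsFrame

variable (hfr : IsFrame ι P u)
include hfr

/-- The vector `u - ι g` is the unnormalised normal of a graph with gradient `g`. -/
lemma inner_sub_apply (g : W) (v : E) : ⟪u - ι g, v⟫_ℝ = ⟪u, v⟫_ℝ - ⟪g, P v⟫_ℝ := by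
  have h1 : ⟪ι g, v⟫_ℝ = ⟪g, P v⟫_ℝ := by
    conv_lhs => rw [← hfr.decomp v]
    rw [inner_add_right, inner_smul_right, real_inner_comm, real_inner_comm u, hfr.inner_eq,
      mul_zero, add_zero, ι.inner_map_map, real_inner_comm]
  rw [inner_sub_left, h1]

lemma inner_sub_apply_unit (g : W) : ⟪u - ι g, u⟫_ℝ = 1 := by
  rw [hfr.inner_sub_apply, hfr.proj_u, hfr.inner_self]
  simp

lemma sub_apply_ne_zero (g : W) : u - ι g ≠ 0 := by
  intro h
  have := hfr.inner_sub_apply_unit g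
  simp [h] at this

lemma continuous_normalize : Continuous fun g : W => ‖u - ι g‖⁻¹ • (u - ι g) := by
  have h : Continuous fun g : W => u - ι g := continuous_const.sub ι.continuous
  exact (h.norm.inv₀ fun g => norm_ne_zero_iff.2 (hfr.sub_apply_ne_zero g)).smul h

/-- The vectors `u - ι g` lie in the affine hyperplane `⟪·, u⟫ = 1`, which a ray from the origin
meets at most once. -/
lemma injective_normalize : Function.Injective fun g : W => ‖u - ι g‖⁻¹ • (u - ι g) := by
  intro g g' h
  have h1 : ‖u - ι g‖⁻¹ = ‖u - ι g'‖⁻¹ := by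
    have := congrArg (fun v => ⟪v, u⟫_ℝ) h
    simpa only [real_inner_smul_left, hfr.inner_sub_apply_unit, mul_one] using this
  simp only [h1] at h
  have h2 := smul_right_injective E (inv_ne_zero (norm_ne_zero_iff.2 (hfr.sub_apply_ne_zero g'))) h
  exact ι.injective (sub_right_injective h2)

/-- The central projection onto the sphere of a compact null set of a hyperplane. -/
lemma isClosedThinInSphere_image [FiniteDimensional ℝ W] [MeasurableSpace W] [BorelSpace W]
    {M : Set W} (hM : IsCompact M) (hM0 : MeasureTheory.volume M = 0) :
    IsClosedThinInSphere ((fun g : W => ‖u - ι g‖⁻¹ • (u - ι g)) '' M) := by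
  refine ⟨(hM.image hfr.continuous_normalize).isClosed, fun v₀ hv₀ ε hε => ?_⟩
  by_cases hv : v₀ ∈ (fun g : W => ‖u - ι g‖⁻¹ • (u - ι g)) '' M
  · obtain ⟨g₀, -, hg₀⟩ := hv
    have hd : Dense Mᶜ :=
      interior_eq_empty_iff_dense_compl.1 (MeasureTheory.Measure.interior_eq_empty_of_null hM0)
    obtain ⟨g, hg, hgM⟩ := hd.inter_open_nonempty _
      (Metric.isOpen_ball.preimage hfr.continuous_normalize)
      ⟨g₀, mem_preimage.2 (hg₀.symm ▸ Metric.mem_ball_self hε : _ ∈ Metric.ball v₀ ε)⟩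
    refine ⟨_, ?_, hg, ?_⟩
    · rw [norm_smul, norm_inv, norm_norm,
        inv_mul_cancel₀ (norm_ne_zero_iff.2 (hfr.sub_apply_ne_zero g))]
    · rintro ⟨g', hg', h⟩
      exact hgM (hfr.injective_normalize h ▸ hg')
  · exact ⟨v₀, hv₀, by simpa using hε, hv⟩

end IsFrame

namespace IsSupportedGraph

variable [CompleteSpace W] (hG : IsSupportedGraph C ι P u f V) (hfr : IsFrame ι P u)
include hG hfr

lemma inner_le (hy : y ∈ V) {a : E} (ha : a ∈ C) :
    ⟪u - ι (gradient f y), a⟫_ℝ ≤ ⟪u - ι (gradient f y), ι y + f y • u⟫_ℝ := by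
  rw [hfr.inner_sub_apply, hfr.inner_sub_apply, hfr.inner_graph, hfr.proj_graph, inner_gradient,
    inner_gradient]
  exact hG.normal y hy a ha

lemma mem_frontier (hy : y ∈ V) : ι y + f y • u ∈ frontier C :=
  ⟨subset_closure (hG.mem y hy), fun hint => lt_irrefl _
    (inner_lt_of_mem_interior (hfr.sub_apply_ne_zero _) (fun _ ha => hG.inner_le hfr hy ha) hint)⟩

/-- The first order condition makes `n` a multiple of `u - ι ∇f`, an interior point of `C` makes the
factor positive, and `‖n‖ = 1` determines it. -/
lemma eq_normal_of_isUnitOuterNormal (hne : (interior C).Nonempty) (hy : y ∈ V)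
    (hf : DifferentiableAt ℝ f y) {n : E} (hn : IsUnitOuterNormal C (ι y + f y • u) n) :
    n = ‖u - ι (gradient f y)‖⁻¹ • (u - ι (gradient f y)) := by
  obtain ⟨c₀, hc₀⟩ := hne
  have h1 := inner_tangent_eq_zero (n := n) (eventually_of_mem (hG.isOpen.mem_nhds hy) hG.mem) hf
    hn.2
  have h2 : n = ⟪n, u⟫_ℝ • (u - ι (gradient f y)) := by
    refine ext_inner_right ℝ fun v => ?_
    rw [real_inner_smul_left, hfr.inner_sub_apply, inner_gradient]
    conv_lhs => rw [← hfr.decomp v, inner_add_right, inner_smul_right]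
    linear_combination h1 (P v)
  have hn0 : n ≠ 0 := fun h => by simpa [h] using hn.1
  have h3 := inner_lt_of_mem_interior hn0 hn.2 hc₀
  have h4 := inner_lt_of_mem_interior (hfr.sub_apply_ne_zero _)
    (fun _ ha => hG.inner_le hfr hy ha) hc₀
  have h5 : 0 < ⟪n, u⟫_ℝ := by
    rw [h2, real_inner_smul_left, real_inner_smul_left] at h3
    by_contra hcon
    nlinarith
  have h6 : ⟪n, u⟫_ℝ * ‖u - ι (gradient f y)‖ = 1 := by
    have := congrArg norm h2
    rw [hn.1, norm_smul, Real.norm_of_nonneg h5.le] at this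
    exact this.symm
  rw [← eq_inv_of_mul_eq_one_left h6]
  exact h2

lemma gaussMap_eq (hne : (interior C).Nonempty) (hy : y ∈ V) (hf : DifferentiableAt ℝ f y) :
    gaussMap C (ι y + f y • u) = ‖u - ι (gradient f y)‖⁻¹ • (u - ι (gradient f y)) := by
  refine hG.eq_normal_of_isUnitOuterNormal hfr hne hy hf (Classical.epsilon_spec ⟨‖u -
    ι (gradient f y)‖⁻¹ • (u - ι (gradient f y)), ?_, fun a ha => ?_⟩)
  · rw [norm_smul, norm_inv, norm_norm,
      inv_mul_cancel₀ (norm_ne_zero_iff.2 (hfr.sub_apply_ne_zero _))]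
  · rw [real_inner_smul_left, real_inner_smul_left]
    exact mul_le_mul_of_nonneg_left (hG.inner_le hfr hy ha) (inv_nonneg.2 (norm_nonneg _))

/-- The graph parametrisation stays in the frontier, so the derivative within the frontier becomes
an ordinary derivative on `W`, which tests it on tangent vectors only. -/
lemma hasFDerivAt_gaussMap_graph (hy : y ∈ V) (hf : DifferentiableAt ℝ f y)
    (hd : DifferentiableWithinAt ℝ (gaussMap C) (frontier C) (ι y + f y • u)) :
    HasFDerivAt (fun z => gaussMap C (ι z + f z • u))
      (fderivWithin ℝ (gaussMap C) (frontier C) (ι y + f y • u) ∘L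
        (ι.toContinuousLinearMap + (fderiv ℝ f y).smulRight u)) y :=
  HasFDerivWithinAt.comp_hasFDerivAt (g := gaussMap C) (f := fun z => ι z + f z • u) y
    hd.hasFDerivWithinAt
    (ι.toContinuousLinearMap.hasFDerivAt.add (hf.hasFDerivAt.smul_const u))
    (eventually_of_mem (hG.isOpen.mem_nhds hy) fun _ hz => hG.mem_frontier hfr hz)

/-- On the frontier near `x` the Gauss map agrees with a map defined in the ambient space, the
normalised `u - ι ∇f(P x')`. -/
lemma differentiableWithinAt_gaussMap (hne : (interior C).Nonempty)
    (hf : ∀ y ∈ V, ContDiffAt ℝ 2 f y) {x : E} (hx : x ∈ frontier C)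
    (hev : ∀ᶠ x' in 𝓝 x, x' ∈ frontier C → P x' ∈ V ∧ ι (P x') + f (P x') • u = x') :
    DifferentiableWithinAt ℝ (gaussMap C) (frontier C) x := by
  obtain ⟨hxV, hxx⟩ := hev.self_of_nhds hx
  have heq : ∀ x', P x' ∈ V → ι (P x') + f (P x') • u = x' →
      gaussMap C x' = ‖u - ι (gradient f (P x'))‖⁻¹ • (u - ι (gradient f (P x'))) := by
    intro x' h1 h2
    conv_lhs => rw [← h2]
    exact hG.gaussMap_eq hfr hne h1 ((hf _ h1).differentiableAt (by norm_num))
  have hd : DifferentiableAt ℝ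
      (fun x' => ‖u - ι (gradient f (P x'))‖⁻¹ • (u - ι (gradient f (P x')))) x := by
    have h1 : DifferentiableAt ℝ (gradient f) (P x) :=
      (hf _ hxV).gradient_of_two.differentiableAt (by norm_num)
    have h2 : DifferentiableAt ℝ (fun x' => u - ι (gradient f (P x'))) x :=
      (differentiableAt_const u).sub (ι.toContinuousLinearMap.differentiableAt.comp x
        (h1.comp x P.differentiableAt))
    exact DifferentiableAt.comp (g := fun z : E => ‖z‖⁻¹ • z) x
      (differentiableAt_inv_norm_smul (hfr.sub_apply_ne_zero _)) h2
  refine hd.differentiableWithinAt.congr_of_eventuallyEq ?_ (heq x hxV hxx)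
  filter_upwards [mem_nhdsWithin_of_mem_nhds hev, self_mem_nhdsWithin] with x' h1 h2
  exact heq x' (h1 h2).1 (h1 h2).2

/-- At the point of tangency, the Gaussian curvature vanishes if the Hessian is singular. -/
lemma gaussianCurvature_eq_zero [FiniteDimensional ℝ E] (hne : (interior C).Nonempty)
    (hf : ∀ y ∈ V, ContDiffAt ℝ 2 f y)
    (hy : y ∈ V) (hy0 : fderiv ℝ f y = 0) {w : W} (hw0 : w ≠ 0)
    (hw : fderiv ℝ (gradient f) y w = 0) : gaussianCurvature C (ι y + f y • u) = 0 := by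
  have hfd : ∀ z ∈ V, DifferentiableAt ℝ f z := fun z hz => (hf z hz).differentiableAt (by norm_num)
  have hgrad : gradient f y = 0 := by
    rw [gradient_eq_rieszRepresentative]
    simp [hy0]
  have hgm : gaussMap C (ι y + f y • u) = u := by
    rw [hG.gaussMap_eq hfr hne hy (hfd y hy), hgrad]
    simp [hfr.norm_eq]
  have hzero : fderivWithin ℝ (gaussMap C) (frontier C) (ι y + f y • u) (ι w) = 0 := by
    -- Without differentiability `fderivWithin` takes the default value zero, and the claim still
    -- holds.
    by_cases hd : DifferentiableWithinAt ℝ (gaussMap C) (frontier C) (ι y + f y • u)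
    · have h1 := hG.hasFDerivAt_gaussMap_graph hfr hy (hfd y hy) hd
      have h2 : HasFDerivAt (fun z => u - ι (gradient f z))
          (-(ι.toContinuousLinearMap ∘L fderiv ℝ (gradient f) y)) y := by
        have := ((hf y hy).gradient_of_two.differentiableAt (by norm_num)).hasFDerivAt
        exact (ι.toContinuousLinearMap.hasFDerivAt.comp y this).const_sub u
      have h3 := HasFDerivAt.comp (g := fun z : E => ‖z‖⁻¹ • z) y
        (differentiableAt_inv_norm_smul (hfr.sub_apply_ne_zero (gradient f y))).hasFDerivAt h2
      have h4 := h1.unique (h3.congr_of_eventuallyEq (eventually_of_mem (hG.isOpen.mem_nhds hy)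
        fun z hz => hG.gaussMap_eq hfr hne hz (hfd z hz)))
      have h5 := congrArg (fun M => M w) h4
      simpa [hw, hy0] using h5
    · rw [fderivWithin_zero_of_not_differentiableWithinAt hd]
      rfl
  have hmem : ι w ∈ (ℝ ∙ gaussMap C (ι y + f y • u))ᗮ := by
    rw [Submodule.mem_orthogonal_singleton_iff_inner_right, hgm]
    exact hfr.inner_eq w
  by_contra hdet
  have hinj := (LinearMap.equivOfDetNeZero _ hdet).injective
  have h6 : (⟨ι w, hmem⟩ : (ℝ ∙ gaussMap C (ι y + f y • u))ᗮ) = 0 := by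
    apply hinj
    rw [map_zero]
    change (ℝ ∙ gaussMap C (ι y + f y • u))ᗮ.orthogonalProjectionOnto
      (fderivWithin ℝ (gaussMap C) (frontier C) (ι y + f y • u) (ι w)) = 0
    rw [hzero, map_zero]
  apply hw0
  have h7 : ι w = 0 := congrArg Subtype.val h6
  exact ι.injective (h7.trans (map_zero ι).symm)

/-- The Hessian is singular wherever the Gaussian curvature vanishes. -/
lemma det_fderiv_gradient_eq_zero [FiniteDimensional ℝ W] (hne : (interior C).Nonempty)
    (hf : ∀ y ∈ V, ContDiffAt ℝ 2 f y)
    (hy : y ∈ V) (hd : DifferentiableWithinAt ℝ (gaussMap C) (frontier C) (ι y + f y • u))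
    (hcurv : gaussianCurvature C (ι y + f y • u) = 0) : (fderiv ℝ (gradient f) y).det = 0 := by
  have hfd : ∀ z ∈ V, DifferentiableAt ℝ f z := fun z hz => (hf z hz).differentiableAt (by norm_num)
  have hN0 := norm_ne_zero_iff.2 (hfr.sub_apply_ne_zero (gradient f y))
  have hgm := hG.gaussMap_eq hfr hne hy (hfd y hy)
  -- A kernel vector of the projected differential is a tangent vector `w` that the unprojected
  -- derivative sends to a multiple of `ν`.
  obtain ⟨w, b, hw0, hνw, hb⟩ : ∃ (w : E) (b : ℝ), w ≠ 0 ∧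
      ⟪gaussMap C (ι y + f y • u), w⟫_ℝ = 0 ∧ b • gaussMap C (ι y + f y • u) =
        fderivWithin ℝ (gaussMap C) (frontier C) (ι y + f y • u) w := by
    obtain ⟨w, hwker, hw0⟩ := (Submodule.ne_bot_iff _).1
      (LinearMap.bot_lt_ker_of_det_eq_zero hcurv).ne'
    have h1 : (ℝ ∙ gaussMap C (ι y + f y • u))ᗮ.orthogonalProjectionOnto
        (fderivWithin ℝ (gaussMap C) (frontier C) (ι y + f y • u) w) = 0 := hwker
    rw [Submodule.orthogonalProjectionOnto_eq_zero_iff, Submodule.orthogonal_orthogonal] at h1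
    obtain ⟨b, hb⟩ := Submodule.mem_span_singleton.1 h1
    exact ⟨w, b, by simpa using hw0, Submodule.mem_orthogonal_singleton_iff_inner_right.1 w.2, hb⟩
  set L := fderivWithin ℝ (gaussMap C) (frontier C) (ι y + f y • u) with hL
  set ν := gaussMap C (ι y + f y • u) with hν
  have huw : ⟪u, w⟫_ℝ = fderiv ℝ f y (P w) := by
    rw [hgm, real_inner_smul_left, hfr.inner_sub_apply, inner_gradient] at hνw
    exact sub_eq_zero.1 ((mul_eq_zero.1 hνw).resolve_left (inv_ne_zero hN0))
  have htan : ι (P w) + fderiv ℝ f y (P w) • u = w := by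
    rw [← huw]
    exact hfr.decomp w
  have hPw0 : P w ≠ 0 := by
    intro h
    apply hw0
    rw [h] at htan
    simpa using htan.symm
  have hgd : HasFDerivAt (gradient f) (fderiv ℝ (gradient f) y) y :=
    ((hf y hy).gradient_of_two.differentiableAt (by norm_num)).hasFDerivAt
  have h2 : HasFDerivAt (fun z => u - ι (gradient f z))
      (-(ι.toContinuousLinearMap ∘L fderiv ℝ (gradient f) y)) y :=
    (ι.toContinuousLinearMap.hasFDerivAt.comp y hgd).const_sub u
  have h3 : DifferentiableAt ℝ (fun z => ‖u - ι (gradient f z)‖) y :=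
    h2.differentiableAt.norm ℝ (hfr.sub_apply_ne_zero _)
  -- Differentiating `‖N‖ ν = N` with `N = u - ι ∇f` along `P w` shows that `ι` of the Hessian
  -- applied to `P w` is parallel to `ν`. Pairing with `u`, to which the range of `ι` is orthogonal
  -- while `⟪u, ν⟫ ≠ 0`, makes it zero.
  have h4 := h3.hasFDerivAt.smul (hG.hasFDerivAt_gaussMap_graph hfr hy (hfd y hy) hd)
  have h5 := h2.unique (h4.congr_of_eventuallyEq (eventually_of_mem (hG.isOpen.mem_nhds hy)
    fun z hz => by
      simp only [Pi.smul_apply']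
      rw [hG.gaussMap_eq hfr hne hz (hfd z hz), smul_smul,
        mul_inv_cancel₀ (norm_ne_zero_iff.2 (hfr.sub_apply_ne_zero _)), one_smul]))
  have h6 : ∃ c : ℝ, -(ι (fderiv ℝ (gradient f) y (P w))) = c • ν := by
    have := congrArg (fun M => M (P w)) h5
    simp only [neg_apply, ContinuousLinearMap.comp_apply, add_apply, smul_apply,
      ContinuousLinearMap.smulRight_apply, LinearIsometry.coe_toContinuousLinearMap] at this
    rw [htan, ← hL, ← hν, ← hb, smul_smul, ← add_smul] at this
    exact ⟨_, this⟩
  obtain ⟨c, hc⟩ := h6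
  have hc0 : c = 0 := by
    have := congrArg (fun v => ⟪u, v⟫_ℝ) hc
    simp only [inner_neg_right, hfr.inner_eq, hgm, inner_smul_right] at this
    rw [real_inner_comm, hfr.inner_sub_apply_unit] at this
    simpa [hN0] using this
  rw [hc0, zero_smul, neg_eq_zero] at hc
  have hker : fderiv ℝ (gradient f) y (P w) = 0 := ι.injective (hc.trans (map_zero ι).symm)
  by_contra hdet
  have hinj := (LinearMap.equivOfDetNeZero
    (fderiv ℝ (gradient f) y : W →ₗ[ℝ] W) hdet).injective
  exact hPw0 (hinj (hker.trans (map_zero _).symm))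

end IsSupportedGraph

/-- The spherical image of the flat points is contained in a countable union of thin closed sets
(by Sard's theorem for the Gauss map). -/
theorem IsCkaConvexBody.exists_thin_cover [FiniteDimensional ℝ E] [CompleteSpace E]
    {k : WithTop ℕ∞} {α : ℝ≥0} (hk : 2 ≤ k) (hα : α ≤ 1) {C : Set E}
    (hC : IsCkaConvexBody k α C) :
    ∃ 𝒯 : Set (Set E), 𝒯.Countable ∧ flatSphericalImage C ⊆ ⋃₀ 𝒯 ∧
      ∀ T ∈ 𝒯, IsClosedThinInSphere T := by
  have hk1 : 1 ≤ k := le_trans (by norm_num) hk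
  have hne := hC.nonempty_interior
  have hloc : ∀ p ∈ frontier C, ∃ U ∈ 𝓝 p, ∃ T : Set E, IsClosedThinInSphere T ∧
      ∀ x ∈ U, x ∈ frontier C → gaussianCurvature C x = 0 → gaussMap C x ∈ T := by
    intro p hp
    obtain ⟨n, hn0, hn⟩ := exists_ne_zero_inner_le hC.convex hne hp
    have hu : ∀ a ∈ C, ⟪‖n‖⁻¹ • n, a⟫_ℝ ≤ ⟪‖n‖⁻¹ • n, p⟫_ℝ := by
      intro a ha
      rw [real_inner_smul_left, real_inner_smul_left]
      exact mul_le_mul_of_nonneg_left (hn a ha) (inv_nonneg.2 (norm_nonneg _))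
    have hu1 : ‖‖n‖⁻¹ • n‖ = 1 := by
      rw [norm_smul, norm_inv, norm_norm, inv_mul_cancel₀ (norm_ne_zero_iff.2 hn0)]
    set u := ‖n‖⁻¹ • n
    have hfr : IsFrame ((ℝ ∙ u)ᗮ).subtypeₗᵢ ((ℝ ∙ u)ᗮ.orthogonalProjectionOnto) u :=
      .orthogonal_span_singleton hu1
    obtain ⟨f, V, hG, hf, hpV, -, -, hev⟩ := hC.exists_tangent_graph hk1 hα hp hu hfr
    have hf2 : ∀ y ∈ V, ContDiffAt ℝ 2 f y := fun y hy => (hf y hy).1.of_le hk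
    set P := (ℝ ∙ u)ᗮ.orthogonalProjectionOnto
    obtain ⟨r, hr, hrV⟩ := Metric.nhds_basis_closedBall.mem_iff.1 (hG.isOpen.mem_nhds hpV)
    -- The critical values of `∇f` over a closed ball: compact by continuity of the Hessian
    -- determinant, and null by Sard's theorem in equal dimensions.
    let M := gradient f '' {y | y ∈ Metric.closedBall (P p) r ∧ (fderiv ℝ (gradient f) y).det = 0}
    have hM : IsCompact M := by
      have hc1 : ContinuousOn (gradient f) (Metric.closedBall (P p) r) := fun y hy =>
        (hf2 y (hrV hy)).gradient_of_two.continuousAt.continuousWithinAt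
      have hc2 : ContinuousOn (fun y => (fderiv ℝ (gradient f) y).det)
          (Metric.closedBall (P p) r) := fun y hy =>
        (ContinuousLinearMap.continuous_det.continuousAt.comp
          ((hf2 y (hrV hy)).gradient_of_two.fderiv_right (m := 0)
            (by norm_num)).continuousAt).continuousWithinAt
      have hcl := hc2.preimage_isClosed_of_isClosed Metric.isClosed_closedBall
        (isClosed_singleton (x := (0 : ℝ)))
      exact ((isCompact_closedBall (P p) r).of_isClosed_subset hcl
        inter_subset_left).image_of_continuousOn (hc1.mono inter_subset_left)
    let _ : MeasurableSpace (ℝ ∙ u)ᗮ := borel _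
    have : BorelSpace (ℝ ∙ u)ᗮ := ⟨rfl⟩
    have hM0 : MeasureTheory.volume M = 0 :=
      MeasureTheory.addHaar_image_eq_zero_of_det_fderivWithin_eq_zero _
        (fun y hy => ((hf2 y (hrV hy.1)).gradient_of_two.differentiableAt
          (by norm_num)).hasFDerivAt.hasFDerivWithinAt) fun y hy => hy.2
    refine ⟨_, (eventually_eventually_nhds.2 hev).and (P.continuous.continuousAt
      (Metric.closedBall_mem_nhds (P p) hr)), _, hfr.isClosedThinInSphere_image hM hM0, ?_⟩
    rintro x ⟨hx1, hx2⟩ hx hcurv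
    have hd := hG.differentiableWithinAt_gaussMap hfr hne hf2 hx hx1
    obtain ⟨hxV, hxx⟩ := hx1.self_of_nhds hx
    rw [← hxx] at hd hcurv
    refine ⟨gradient f (P x), ⟨P x, ⟨hx2, ?_⟩, rfl⟩, ?_⟩
    · exact hG.det_fderiv_gradient_eq_zero hfr hne hf2 hxV hd hcurv
    · rw [← hxx, hG.gaussMap_eq hfr hne hxV ((hf2 _ hxV).differentiableAt (by norm_num)), hxx]
  choose! U hU T hT hUT using hloc
  obtain ⟨t, hcov⟩ := (hC.isCompact.of_isClosed_subset isClosed_frontier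
    hC.isCompact.isClosed.frontier_subset).elim_nhds_subcover' (fun p hp => U p) hU
  refine ⟨(fun p : frontier C => T p) '' t, t.finite_toSet.countable.image _, ?_, ?_⟩
  · rintro v ⟨x, ⟨hx, hcurv⟩, rfl⟩
    obtain ⟨p, hpt, hxp⟩ := mem_iUnion₂.1 (hcov hx)
    exact ⟨_, mem_image_of_mem _ hpt, hUT p p.2 x hxp hx hcurv⟩
  · rintro _ ⟨p, -, rfl⟩
    exact hT p p.2

end GaussMap

/-! ### Regularity of the Minkowski sum when flat normals do not meet. -/

section MinkowskiSum

open Filter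

variable {E : Type} [NormedAddCommGroup E] [InnerProductSpace ℝ E]
variable {W : Type} [NormedAddCommGroup W] [InnerProductSpace ℝ W]
variable {C : Set E} {ι : W →ₗᵢ[ℝ] E} {P : E →L[ℝ] W} {u : E} {f : W → ℝ} {V : Set W} {y : W}

lemma eq_zero_of_inner_apply_self_eq_zero {F : Type*} [NormedAddCommGroup F]
    [InnerProductSpace ℝ F] {H : F →L[ℝ] F} (hsymm : ∀ v w, ⟪H v, w⟫_ℝ = ⟪H w, v⟫_ℝ)
    (hneg : ∀ w, ⟪H w, w⟫_ℝ ≤ 0) {w : F} (hw : ⟪H w, w⟫_ℝ = 0) : H w = 0 := by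
  by_contra h0
  have hs : 0 < ⟪H w, H w⟫_ℝ := real_inner_self_pos.2 h0
  set s := ⟪H w, H w⟫_ℝ with hsdef
  set c := ⟪H (H w), H w⟫_ℝ with hc
  have hexp : ∀ t : ℝ, 2 * t * s + t ^ 2 * c ≤ 0 := by
    intro t
    have h := hneg (w + t • H w)
    simp only [map_add, map_smul, inner_add_left, inner_add_right, real_inner_smul_left,
      real_inner_smul_right] at h
    rw [hw, hsymm (H w) w, ← hsdef, ← hc] at h
    linarith
  -- For this `t` one has `t |c| ≤ s`, so `2 t s + t² c ≥ t s > 0`, against `hexp`.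
  have h1 := hexp (s / (1 + |c|))
  have hd : 0 < 1 + |c| := by positivity
  have h2 : 0 < s / (1 + |c|) := div_pos hs hd
  have h3 : s / (1 + |c|) * (1 + |c|) = s := div_mul_cancel₀ _ hd.ne'
  set t := s / (1 + |c|)
  have h4 : -|c| ≤ c := neg_abs_le c
  nlinarith [mul_nonneg h2.le (sub_nonneg.2 h4), mul_pos h2 hs, mul_pos h2 h2]

lemma mem_frontier_of_inner_le {x n : E} (hn : n ≠ 0) (hx : x ∈ C)
    (h : ∀ a ∈ C, ⟪n, a⟫_ℝ ≤ ⟪n, x⟫_ℝ) : x ∈ frontier C :=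
  ⟨subset_closure hx, fun hint => lt_irrefl _ (inner_lt_of_mem_interior hn h hint)⟩

lemma inner_fderiv_gradient_comm [CompleteSpace W] (hf : ContDiffAt ℝ 2 f y) (v w : W) :
    ⟪fderiv ℝ (gradient f) y v, w⟫_ℝ = ⟪fderiv ℝ (gradient f) y w, v⟫_ℝ := by
  rw [inner_fderiv_gradient hf, inner_fderiv_gradient hf]
  exact (hf.isSymmSndFDerivAt (by simp)).eq v w

namespace IsSupportedGraph

variable (hG : IsSupportedGraph C ι P u f V) (hfr : IsFrame ι P u)
include hG hfr

/-- Adding the supporting inequalities at `y` and at `y + t w` shows that `∇f` is monotone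
decreasing along `w`, so its difference quotients are nonpositive. -/
lemma inner_fderiv_gradient_nonpos [CompleteSpace W] (hy : y ∈ V) (hf : ContDiffAt ℝ 2 f y) (w : W) :
    ⟪fderiv ℝ (gradient f) y w, w⟫_ℝ ≤ 0 := by
  have hl : HasDerivAt (fun t : ℝ => y + t • w) w 0 := by
    simpa using ((hasDerivAt_id (0 : ℝ)).smul_const w).const_add y
  have hgd : HasFDerivAt (gradient f) (fderiv ℝ (gradient f) y) (y + (0 : ℝ) • w) := by
    simpa using (hf.gradient_of_two.differentiableAt (by norm_num)).hasFDerivAt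
  have hd : HasDerivAt (fun t : ℝ => ⟪gradient f (y + t • w), w⟫_ℝ)
      ⟪fderiv ℝ (gradient f) y w, w⟫_ℝ 0 := by
    simpa using (hgd.comp_hasDerivAt (0 : ℝ) hl).inner ℝ (hasDerivAt_const (0 : ℝ) w)
  have hV : ∀ᶠ t in 𝓝 (0 : ℝ), y + t • w ∈ V :=
    hl.continuousAt (by simpa using hG.isOpen.mem_nhds hy)
  refine le_of_tendsto (hasDerivAt_iff_tendsto_slope.1 hd) ?_
  filter_upwards [mem_nhdsWithin_of_mem_nhds hV, self_mem_nhdsWithin] with t ht ht0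
  have h1 := hG.normal y hy _ (hG.mem _ ht)
  have h2 := hG.normal _ ht _ (hG.mem _ hy)
  rw [hfr.inner_graph, hfr.proj_graph] at h1 h2
  rw [map_add, map_smul, smul_eq_mul] at h1 h2
  rw [slope_def_field, zero_smul, add_zero, sub_zero, inner_gradient, inner_gradient]
  have h3 : t * (fderiv ℝ f (y + t • w) w - fderiv ℝ f y w) ≤ 0 := by linarith
  rcases lt_or_gt_of_ne (show t ≠ 0 from ht0) with h | h
  · exact div_nonpos_of_nonneg_of_nonpos (by nlinarith) h.le
  · exact div_nonpos_of_nonpos_of_nonneg (by nlinarith) h.le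

/-- The inward ray along the normal at a point of tangency enters the interior. -/
lemma exists_sub_smul_mem_interior [CompleteSpace E] [CompleteSpace W] (hC : Convex ℝ C)
    (hne : (interior C).Nonempty) (hy : y ∈ V) (hf : DifferentiableAt ℝ f y)
    (hy0 : fderiv ℝ f y = 0) : ∃ ε > (0 : ℝ), ι y + f y • u - ε • u ∈ interior C := by
  -- Otherwise a hyperplane separates the interior from the ray. Its normal is an outer normal at
  -- the point, hence a positive multiple of `u`, and then it strictly decreases along the ray,
  -- which is absurd.
  by_contra! hcon
  obtain ⟨c₀, hc₀⟩ := id hne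
  set p := ι y + f y • u with hp
  have hray : Convex ℝ ((AffineMap.lineMap p (p - u) : ℝ →ᵃ[ℝ] E) '' Ioi 0) :=
    (convex_Ioi 0).affine_image _
  have hmem : ∀ t : ℝ, AffineMap.lineMap p (p - u) t = p - t • u := by
    intro t
    simp [AffineMap.lineMap_apply]
    abel
  obtain ⟨l, r, hl, hr⟩ := geometric_hahn_banach_open hC.interior isOpen_interior hray (by
    rw [Set.disjoint_right]
    rintro _ ⟨t, ht, rfl⟩
    rw [hmem]
    exact hcon t ht)
  have hr' : ∀ t > 0, r ≤ l p - t * l u := by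
    intro t ht
    have := hr _ (mem_image_of_mem _ ht)
    rwa [hmem, map_sub, map_smul, smul_eq_mul] at this
  have hrp : r ≤ l p := by
    have hc : Tendsto (fun t : ℝ => l p - t * l u) (𝓝[>] 0) (𝓝 (l p)) := by
      have : Continuous fun t : ℝ => l p - t * l u := by fun_prop
      have := this.tendsto 0
      simp only [zero_mul, sub_zero] at this
      exact this.mono_left nhdsWithin_le_nhds
    exact ge_of_tendsto hc (eventually_of_mem self_mem_nhdsWithin hr')
  have hlC : ∀ a ∈ C, l a ≤ r := by
    intro a ha
    have h1 : a ∈ closure (interior C) := by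
      rw [hC.closure_interior_eq_closure_of_nonempty_interior hne]
      exact subset_closure ha
    exact closure_minimal (fun z hz => (hl z hz).le) (isClosed_le l.continuous continuous_const) h1
  set n := (InnerProductSpace.toDual ℝ E).symm l
  have hnl : ∀ v, ⟪n, v⟫_ℝ = l v := fun v => InnerProductSpace.toDual_symm_apply
  have hn0 : n ≠ 0 := by
    intro h
    have h1 := hnl c₀
    have h2 := hnl p
    rw [h, inner_zero_left] at h1 h2
    have := hl c₀ hc₀
    linarith
  have hnn : 0 < ‖n‖ := norm_pos_iff.2 hn0
  have hnu : ‖n‖⁻¹ • n = u := by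
    have h1 : IsUnitOuterNormal C p (‖n‖⁻¹ • n) := by
      refine ⟨by rw [norm_smul, norm_inv, norm_norm, inv_mul_cancel₀ hnn.ne'], fun a ha => ?_⟩
      rw [real_inner_smul_left, real_inner_smul_left, hnl, hnl]
      exact mul_le_mul_of_nonneg_left ((hlC a ha).trans hrp) (inv_nonneg.2 hnn.le)
    rw [hG.eq_normal_of_isUnitOuterNormal hfr hne hy hf h1, gradient_eq_rieszRepresentative]
    simp [hy0, hfr.norm_eq]
  have hlu : 0 < l u := by
    have h1 : ⟪‖n‖⁻¹ • n, u⟫_ℝ = 1 := by rw [hnu, hfr.inner_self]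
    rw [real_inner_smul_left, hnl] at h1
    exact pos_of_mul_pos_right (h1 ▸ one_pos) (inv_nonneg.2 hnn.le)
  have h1 := hr' 1 one_pos
  have h2 := hlC p (hG.mem y hy)
  linarith

/-- A supported graph describes the whole boundary near a point where the inward normal ray enters
the interior. -/
lemma exists_isOpen_mem_frontier_iff [CompleteSpace W] (hC : Convex ℝ C) (hCc : IsClosed C)
    (hy : y ∈ V) {ε : ℝ} (hε : 0 < ε) (hint : ι y + f y • u - ε • u ∈ interior C) :
    ∃ U : Set E, IsOpen U ∧ ι y + f y • u ∈ U ∧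
      ∀ x ∈ U, x ∈ frontier C ↔ ⟪u, x⟫_ℝ = f (P x) := by
  have hcont : Continuous fun x => ι (P x) + (f y - ε) • u :=
    (ι.continuous.comp P.continuous).add continuous_const
  have hcu : Continuous fun x => ⟪u, x⟫_ℝ := continuous_const.inner continuous_id
  -- In this neighbourhood the point at height `f y - ε` below `x` is interior. If `x` is strictly
  -- below the graph, it lies on an open segment from that point to the graph and is itself
  -- interior.
  refine ⟨P ⁻¹' V ∩ (fun x => ι (P x) + (f y - ε) • u) ⁻¹' interior C ∩
    {x | f y - ε < ⟪u, x⟫_ℝ}, ?_, ?_, ?_⟩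
  · exact ((hG.isOpen.preimage P.continuous).inter (isOpen_interior.preimage hcont)).inter
      (isOpen_lt continuous_const hcu)
  · refine ⟨⟨?_, ?_⟩, ?_⟩
    · rw [mem_preimage, hfr.proj_graph]
      exact hy
    · rw [mem_preimage, hfr.proj_graph, sub_smul, ← add_sub_assoc]
      exact hint
    · rw [mem_ofPred_eq, hfr.inner_graph]
      linarith
  · rintro x ⟨⟨hxV, hxint⟩, hxt⟩
    rw [mem_preimage] at hxV hxint
    rw [mem_ofPred_eq] at hxt
    constructor
    · intro hx
      have hle : ⟪u, x⟫_ℝ ≤ f (P x) := by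
        have := hG.normal _ hxV x (hCc.frontier_subset hx)
        linarith
      refine hle.eq_of_not_lt fun hlt => hx.2 ?_
      apply hC.openSegment_interior_self_subset_interior hxint (hG.mem _ hxV)
      have hpos : 0 < f (P x) - (f y - ε) := by linarith
      refine ⟨(f (P x) - ⟪u, x⟫_ℝ) / (f (P x) - (f y - ε)),
        (⟪u, x⟫_ℝ - (f y - ε)) / (f (P x) - (f y - ε)), div_pos (by linarith) hpos,
        div_pos (by linarith) hpos, ?_, ?_⟩
      · field_simp
        ring
      · conv_rhs => rw [← hfr.decomp x]
        have hab : (f (P x) - ⟪u, x⟫_ℝ) / (f (P x) - (f y - ε)) +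
            (⟪u, x⟫_ℝ - (f y - ε)) / (f (P x) - (f y - ε)) = 1 := by
          field_simp
          ring
        have hcomb : (f (P x) - ⟪u, x⟫_ℝ) / (f (P x) - (f y - ε)) * (f y - ε) +
            (⟪u, x⟫_ℝ - (f y - ε)) / (f (P x) - (f y - ε)) * f (P x) = ⟪u, x⟫_ℝ := by
          field_simp
          ring
        rw [smul_add, smul_add, smul_smul, smul_smul, add_add_add_comm, ← add_smul, ← add_smul, hab,
          hcomb, one_smul]
    · intro hx
      have := hG.mem_frontier hfr hxV
      rwa [← hx, hfr.decomp] at this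

end IsSupportedGraph

/-- If one of the Hessians of two supported graphs over the same hyperplane is nonsingular at points
with horizontal tangents, the Minkowski sum has a supported graph of the same class. -/
theorem IsSupportedGraph.exists_add [FiniteDimensional ℝ W] [CompleteSpace W] {A B : Set E}
    {g : W → ℝ} {V' : Set W}
    {j : WithTop ℕ∞} {α : ℝ≥0} (hj : 1 ≤ j) (hα : α ≤ 1) (hfr : IsFrame ι P u)
    (hA : IsSupportedGraph A ι P u f V) (hB : IsSupportedGraph B ι P u g V')
    (hf : ∀ y ∈ V, CkaAt (j + 1) α f y) (hg : ∀ y ∈ V', CkaAt (j + 1) α g y) {y₁ y₂ : W}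
    (hy₁ : y₁ ∈ V) (hy₂ : y₂ ∈ V') (hf0 : fderiv ℝ f y₁ = 0) (hg0 : fderiv ℝ g y₂ = 0)
    (hH : (∀ w, fderiv ℝ (gradient f) y₁ w = 0 → w = 0) ∨
      ∀ w, fderiv ℝ (gradient g) y₂ w = 0 → w = 0) :
    ∃ (h : W → ℝ) (V'' : Set W), IsSupportedGraph (A + B) ι P u h V'' ∧
      (∀ y ∈ V'', CkaAt (j + 1) α h y) ∧ y₁ + y₂ ∈ V'' ∧ h (y₁ + y₂) = f y₁ + g y₂ := by
  have hj0 : j ≠ 0 := fun h => by simp [h] at hj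
  have h2j : (2 : WithTop ℕ∞) ≤ j + 1 := by
    rw [← one_add_one_eq_two]
    exact add_le_add_left hj 1
  have hj10 : j + 1 ≠ 0 := fun h => by simp [h] at h2j
  have hf2 : ContDiffAt ℝ 2 f y₁ := (hf y₁ hy₁).1.of_le h2j
  have hg2 : ContDiffAt ℝ 2 g y₂ := (hg y₂ hy₂).1.of_le h2j
  have hfg : HasFDerivAt (gradient f) (fderiv ℝ (gradient f) y₁) y₁ :=
    (hf2.gradient_of_two.differentiableAt (by norm_num)).hasFDerivAt
  have hgg : HasFDerivAt (gradient g) (fderiv ℝ (gradient g) y₂) y₂ :=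
    (hg2.gradient_of_two.differentiableAt (by norm_num)).hasFDerivAt
  set Hf := fderiv ℝ (gradient f) y₁
  set Hg := fderiv ℝ (gradient g) y₂
  -- If the sum kills `w`, both nonpositive quadratic forms vanish at `w`, and semidefiniteness puts
  -- `w` in both kernels.
  have hnondeg : ∀ w, Hf w + Hg w = 0 → w = 0 := by
    intro w hw
    have h1 := hA.inner_fderiv_gradient_nonpos hfr hy₁ hf2
    have h2 := hB.inner_fderiv_gradient_nonpos hfr hy₂ hg2
    have h3 : ⟪Hf w, w⟫_ℝ + ⟪Hg w, w⟫_ℝ = 0 := by rw [← inner_add_left, hw, inner_zero_left]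
    have h4 := h1 w
    have h5 := h2 w
    rcases hH with hH | hH
    · exact hH w (eq_zero_of_inner_apply_self_eq_zero (inner_fderiv_gradient_comm hf2) h1
        (by linarith))
    · exact hH w (eq_zero_of_inner_apply_self_eq_zero (inner_fderiv_gradient_comm hg2) h2
        (by linarith))
  -- Solving `Ψ = (z, 0)` splits `z` into two base points at which the graphs have the same normal.
  let Ψ : W × W → W × W := fun q => (q.1 + q.2, gradient f q.1 - gradient g q.2)
  have hVV : ∀ᶠ q in 𝓝 (y₁, y₂), q.1 ∈ V ∧ q.2 ∈ V' :=
    prod_mem_nhds (hA.isOpen.mem_nhds hy₁) (hB.isOpen.mem_nhds hy₂)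
  have hΨ : ∀ᶠ q in 𝓝 (y₁, y₂), CkaAt j α Ψ q := by
    filter_upwards [hVV] with q hq
    refine CkaAt.prodMk (.of_contDiffAt_omega hα contDiff_add.contDiffAt) (CkaAt.sub hα ?_ ?_)
    · exact CkaAt.comp hα (f := Prod.fst) ((hf _ hq.1).gradient_of_succ hα)
        (.of_contDiffAt_omega hα contDiff_fst.contDiffAt) contDiff_fst.contDiffAt
    · exact CkaAt.comp hα (f := Prod.snd) ((hg _ hq.2).gradient_of_succ hα)
        (.of_contDiffAt_omega hα contDiff_snd.contDiffAt) contDiff_snd.contDiffAt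
  have hder : HasFDerivAt Ψ ((ContinuousLinearMap.fst ℝ W W + ContinuousLinearMap.snd ℝ W W).prod
      (Hf ∘L ContinuousLinearMap.fst ℝ W W - Hg ∘L ContinuousLinearMap.snd ℝ W W)) (y₁, y₂) :=
    ((ContinuousLinearMap.fst ℝ W W).hasFDerivAt.add
      (ContinuousLinearMap.snd ℝ W W).hasFDerivAt).prodMk
      ((HasFDerivAt.comp (g := gradient f) (y₁, y₂) hfg
        (ContinuousLinearMap.fst ℝ W W).hasFDerivAt).sub
      (HasFDerivAt.comp (g := gradient g) (y₁, y₂) hgg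
        (ContinuousLinearMap.snd ℝ W W).hasFDerivAt))
  obtain ⟨T, hT⟩ := ContinuousLinearMap.exists_equiv_of_injective rfl
    ((ContinuousLinearMap.fst ℝ W W + ContinuousLinearMap.snd ℝ W W).prod
      (Hf ∘L ContinuousLinearMap.fst ℝ W W - Hg ∘L ContinuousLinearMap.snd ℝ W W)) (by
    rintro ⟨v, w⟩ hz
    have h1 : v + w = 0 := congrArg Prod.fst hz
    have h2 : Hf v - Hg w = 0 := congrArg Prod.snd hz
    obtain rfl : w = -v := eq_neg_of_add_eq_zero_right h1
    rw [map_neg, sub_neg_eq_add] at h2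
    rw [hnondeg v h2, neg_zero]
    rfl)
  rw [← hT] at hder
  obtain ⟨s, hs0, hs1, -, hs3⟩ := CkaAt.exists_local_inverse hα hj hΨ hder
  have hgradf : gradient f y₁ = 0 := by
    rw [gradient_eq_rieszRepresentative]
    simp [hf0]
  have hgradg : gradient g y₂ = 0 := by
    rw [gradient_eq_rieszRepresentative]
    simp [hg0]
  have hΨ0 : Ψ (y₁, y₂) = (y₁ + y₂, 0) := by simp [Ψ, hgradf, hgradg]
  rw [hΨ0] at hs0 hs1 hs3
  have hinA : ContDiff ℝ ⊤ (fun z : W => (z, (0 : W))) := contDiff_id.prodMk contDiff_const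
  have hin1 : Tendsto (fun z : W => (z, (0 : W))) (𝓝 (y₁ + y₂)) (𝓝 (y₁ + y₂, 0)) :=
    hinA.continuous.tendsto _
  let η₁ : W → W := fun z => (s (z, 0)).1
  let η₂ : W → W := fun z => (s (z, 0)).2
  let h : W → ℝ := fun z => f (η₁ z) + g (η₂ z)
  have hsC : ∀ᶠ z in 𝓝 (y₁ + y₂), CkaAt j α (fun z => s (z, 0)) z := by
    filter_upwards [hin1.eventually hs3] with z hz
    exact CkaAt.comp hα (f := fun z : W => (z, (0 : W))) hz
      (.of_contDiffAt_omega hα hinA.contDiffAt) (hinA.contDiffAt.of_le le_top)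
  have hηC : ∀ᶠ z in 𝓝 (y₁ + y₂), CkaAt j α η₁ z ∧ CkaAt j α η₂ z := by
    filter_upwards [hsC] with z hz
    exact ⟨CkaAt.omega_comp hα (g := Prod.fst) contDiff_fst.contDiffAt hz,
      CkaAt.omega_comp hα (g := Prod.snd) contDiff_snd.contDiffAt hz⟩
  have hsol : ∀ᶠ z in 𝓝 (y₁ + y₂), η₁ z + η₂ z = z ∧ gradient f (η₁ z) = gradient g (η₂ z) := by
    filter_upwards [hin1.eventually hs1] with z hz
    exact ⟨congrArg Prod.fst hz, sub_eq_zero.1 (congrArg Prod.snd hz)⟩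
  have hηV : ∀ᶠ z in 𝓝 (y₁ + y₂), η₁ z ∈ V ∧ η₂ z ∈ V' := by
    have hc : Tendsto (fun z => s (z, 0)) (𝓝 (y₁ + y₂)) (𝓝 (y₁, y₂)) := by
      simpa only [ContinuousAt, hs0] using hsC.self_of_nhds.continuousAt
    exact hc.eventually hVV
  -- Envelope argument: the differentials of `f` and `g` agree at `η₁ z`, `η₂ z`, and those of `η₁`,
  -- `η₂` add up to the identity, so the derivatives of `η₁` and `η₂` drop out.
  have hder : ∀ᶠ z in 𝓝 (y₁ + y₂), HasFDerivAt h (fderiv ℝ f (η₁ z)) z := by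
    filter_upwards [hηC, hηV, hsol, eventually_eventually_nhds.2 hsol] with z hC hV hz hz'
    have hd1 := (hC.1.1.differentiableAt hj0).hasFDerivAt
    have hd2 := (hC.2.1.differentiableAt hj0).hasFDerivAt
    have hdf := ((hf _ hV.1).1.differentiableAt hj10).hasFDerivAt
    have hdg := ((hg _ hV.2).1.differentiableAt hj10).hasFDerivAt
    have heq : fderiv ℝ g (η₂ z) = fderiv ℝ f (η₁ z) := by
      ext w
      rw [← inner_gradient, ← inner_gradient, hz.2]
    have hid : fderiv ℝ η₁ z + fderiv ℝ η₂ z = ContinuousLinearMap.id ℝ W :=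
      (hd1.add hd2).unique ((hasFDerivAt_id z).congr_of_eventuallyEq
        (hz'.mono fun z hz => hz.1))
    have hsum := (hdf.comp z hd1).add (hdg.comp z hd2)
    rw [heq, ← ContinuousLinearMap.comp_add, hid, ContinuousLinearMap.comp_id] at hsum
    exact hsum
  have hhC : ∀ᶠ z in 𝓝 (y₁ + y₂), CkaAt (j + 1) α h z := by
    filter_upwards [hηC, hηV, hder, eventually_eventually_nhds.2 hder] with z hC hV hz hz'
    have h1 : CkaAt j α h z :=
      CkaAt.add hα (CkaAt.comp hα ((hf _ hV.1).pred hα) hC.1 (hC.1.1.of_le hj))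
        (CkaAt.comp hα ((hg _ hV.2).pred hα) hC.2 (hC.2.1.of_le hj))
    refine h1.succ_of_fderiv (hz'.mono fun z hz => hz.differentiableAt) ?_
    exact (CkaAt.comp hα (g := fderiv ℝ f) (hf _ hV.1).fderiv_of_succ hC.1
      (hC.1.1.of_le hj)).congr (hz'.mono fun z hz => hz.fderiv.symm)
  obtain ⟨V'', hVsub, hVo, hyV⟩ := mem_nhds_iff.1 (hhC.and (hηV.and (hsol.and hder)))
  refine ⟨h, V'', ⟨hVo, fun z hz => ?_, fun z hz => ?_⟩, fun z hz => (hVsub hz).1, hyV, ?_⟩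
  · obtain ⟨-, hV, hz', -⟩ := hVsub hz
    refine Set.mem_add.2 ⟨_, hA.mem _ hV.1, _, hB.mem _ hV.2, ?_⟩
    have hιz : ι z = ι (η₁ z) + ι (η₂ z) := by rw [← map_add, hz'.1]
    simp only [h]
    rw [hιz, add_smul]
    abel
  · rintro _ ⟨a, ha, b, hb, rfl⟩
    obtain ⟨-, hV, hz', hd⟩ := hVsub hz
    have heq : fderiv ℝ g (η₂ z) = fderiv ℝ f (η₁ z) := by
      ext w
      rw [← inner_gradient, ← inner_gradient, hz'.2]
    have h1 := hA.normal _ hV.1 a ha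
    have h2 := hB.normal _ hV.2 b hb
    rw [heq] at h2
    have h3 : fderiv ℝ f (η₁ z) (η₁ z) + fderiv ℝ f (η₁ z) (η₂ z) = fderiv ℝ f (η₁ z) z := by
      rw [← map_add, hz'.1]
    rw [hd.fderiv, map_add, map_add, inner_add_right]
    simp only [h]
    linarith
  · simp only [h, η₁, η₂, hs0]

lemma IsSupportedGraph.image_isometry (R : E ≃ₗᵢ[ℝ] E)
    (hG : IsSupportedGraph C (R.symm.toLinearIsometry.comp ι)
      (P ∘L (R.symm.symm.toContinuousLinearEquiv : E →L[ℝ] E)) (R.symm u) f V) :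
    IsSupportedGraph (R '' C) ι P u f V where
  isOpen := hG.isOpen
  mem y hy := ⟨_, hG.mem y hy, by simp⟩
  normal := by
    rintro y hy _ ⟨a, ha, rfl⟩
    have h1 := hG.normal y hy a ha
    have h2 : ⟪R.symm u, a⟫_ℝ = ⟪u, R a⟫_ℝ := by
      rw [← R.inner_map_map, R.apply_symm_apply]
    rw [h2] at h1
    exact h1

/-- The Minkowski sum of `R(A)` and `B` is of class `C^{k,α}` if no normal of a flat point of `A` is
taken by `R` to a normal of a flat point of `B`. -/
theorem IsCkaConvexBody.image_isometry_add [FiniteDimensional ℝ E] [CompleteSpace E]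
    {k : WithTop ℕ∞} {α : ℝ≥0} (hk : 2 ≤ k) (hα : α ≤ 1) {A B : Set E}
    (hA : IsCkaConvexBody k α A) (hB : IsCkaConvexBody k α B) (R : E ≃ₗᵢ[ℝ] E)
    (hR : ∀ v ∈ flatSphericalImage A, R v ∉ flatSphericalImage B) :
    IsCkaConvexBody k α (R '' A + B) := by
  have hk1 : 1 ≤ k := le_trans (by norm_num) hk
  -- For `k = ∞` or `ω`, `j` is `k` itself.
  obtain ⟨j, hj, rfl⟩ : ∃ j : WithTop ℕ∞, 1 ≤ j ∧ k = j + 1 := by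
    induction k using WithTop.recTopCoe with
    | top => exact ⟨⊤, le_top, rfl⟩
    | coe k =>
      induction k using ENat.recTopCoe with
      | top => exact ⟨((⊤ : ℕ∞) : WithTop ℕ∞), by exact_mod_cast le_top, rfl⟩
      | coe m =>
        have hk' : ((2 : ℕ) : WithTop ℕ∞) ≤ (m : ℕ) := hk
        have hm : 2 ≤ m := by exact_mod_cast hk'
        obtain ⟨i, rfl⟩ := Nat.exists_eq_add_of_le hm
        exact ⟨(i + 1 : ℕ), by exact_mod_cast Nat.le_add_left 1 i, by norm_cast; ring_nf⟩
  have hRA : IsCompact (R '' A) := hA.isCompact.image R.continuous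
  have hRAc : Convex ℝ (R '' A) := hA.convex.linear_image R.toLinearEquiv.toLinearMap
  have hconv : Convex ℝ (R '' A + B) := hRAc.add hB.convex
  have hcomp : IsCompact (R '' A + B) := hRA.add hB.isCompact
  have hint : (interior (R '' A + B)).Nonempty := by
    obtain ⟨a, ha⟩ := hA.nonempty_interior
    obtain ⟨b, hb⟩ := hB.nonempty_interior
    exact ⟨R a + b, subset_interior_add_right
      (Set.add_mem_add (mem_image_of_mem R (interior_subset ha)) hb)⟩
  refine ⟨hconv, hcomp, hint, fun x hx => ?_⟩
  obtain ⟨n, hn0, hn⟩ := exists_ne_zero_inner_le hconv hint hx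
  have hu : ∀ a ∈ R '' A + B, ⟪‖n‖⁻¹ • n, a⟫_ℝ ≤ ⟪‖n‖⁻¹ • n, x⟫_ℝ := by
    intro a ha
    rw [real_inner_smul_left, real_inner_smul_left]
    exact mul_le_mul_of_nonneg_left (hn a ha) (inv_nonneg.2 (norm_nonneg _))
  have hu1 : ‖‖n‖⁻¹ • n‖ = 1 := by
    rw [norm_smul, norm_inv, norm_norm, inv_mul_cancel₀ (norm_ne_zero_iff.2 hn0)]
  set u := ‖n‖⁻¹ • n
  have hu0 : u ≠ 0 := fun h => by simp [h] at hu1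
  obtain ⟨_, ⟨a, ha, rfl⟩, b, hb, rfl⟩ := Set.mem_add.1 (hcomp.isClosed.frontier_subset hx)
  have hinner : ∀ v, ⟪R.symm u, v⟫_ℝ = ⟪u, R v⟫_ℝ := fun v => by
    rw [← R.inner_map_map, R.apply_symm_apply]
  have hua : ∀ a' ∈ A, ⟪R.symm u, a'⟫_ℝ ≤ ⟪R.symm u, a⟫_ℝ := by
    intro a' ha'
    have h1 := hu _ (Set.add_mem_add (mem_image_of_mem R ha') hb)
    rw [inner_add_right, inner_add_right] at h1
    rw [hinner, hinner]
    linarith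
  have hub : ∀ b' ∈ B, ⟪u, b'⟫_ℝ ≤ ⟪u, b⟫_ℝ := by
    intro b' hb'
    have h1 := hu _ (Set.add_mem_add (mem_image_of_mem R ha) hb')
    rw [inner_add_right, inner_add_right] at h1
    linarith
  have hfrA : a ∈ frontier A := mem_frontier_of_inner_le (by simpa using hu0) ha hua
  have hfrB : b ∈ frontier B := mem_frontier_of_inner_le hu0 hb hub
  have hfr : IsFrame ((ℝ ∙ u)ᗮ).subtypeₗᵢ ((ℝ ∙ u)ᗮ.orthogonalProjectionOnto) u :=
    .orthogonal_span_singleton hu1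
  -- Rotating the frame back by `R⁻¹` describes `A` over the same space `W` as `B`, so the two graph
  -- functions can be added.
  have hfr' := hfr.comp_isometry R.symm
  obtain ⟨f, V, hGf, hf, hyf, hpf, hf0, -⟩ := hA.exists_tangent_graph hk1 hα hfrA hua hfr'
  obtain ⟨g, V', hGg, hg, hyg, hpg, hg0, -⟩ := hB.exists_tangent_graph hk1 hα hfrB hub hfr
  have hflat : ∀ {C : Set E} {ι : (ℝ ∙ u)ᗮ →ₗᵢ[ℝ] E} {P : E →L[ℝ] (ℝ ∙ u)ᗮ} {v : E}
      {φ : (ℝ ∙ u)ᗮ → ℝ} {O : Set (ℝ ∙ u)ᗮ} {y : (ℝ ∙ u)ᗮ}, IsCkaConvexBody (j + 1) α C →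
      IsFrame ι P v → IsSupportedGraph C ι P v φ O → (∀ y ∈ O, CkaAt (j + 1) α φ y) → y ∈ O →
      fderiv ℝ φ y = 0 → (∀ w, fderiv ℝ (gradient φ) y w = 0 → w = 0) ∨
        v ∈ flatSphericalImage C := by
    intro C ι P v φ O y hC hfr hG hφ hy hy0
    have hφ2 : ∀ y ∈ O, ContDiffAt ℝ 2 φ y := fun y hy => (hφ y hy).1.of_le hk
    by_contra! hcon
    obtain ⟨⟨w, hw, hw0⟩, hv⟩ := hcon
    refine hv ⟨ι y + φ y • v, ⟨hG.mem_frontier hfr hy,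
      hG.gaussianCurvature_eq_zero hfr hC.nonempty_interior hφ2 hy hy0 hw0 hw⟩, ?_⟩
    rw [hG.gaussMap_eq hfr hC.nonempty_interior hy ((hφ2 y hy).differentiableAt (by norm_num)),
      gradient_eq_rieszRepresentative]
    simp [hy0, hfr.norm_eq]
  have hH := hflat hA hfr' hGf hf hyf hf0
  have hH' := hflat hB hfr hGg hg hyg hg0
  have hnondeg := hH.imp_right fun hv => hH'.resolve_right fun hu => hR _ hv
    (by rwa [R.apply_symm_apply])
  obtain ⟨h, V'', hGh, hh, hyh, hhval⟩ := IsSupportedGraph.exists_add hj hα hfr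
    (hGf.image_isometry R) hGg hf hg hyf hyg hf0 hg0 hnondeg
  have hpa : ((ℝ ∙ u)ᗮ).subtypeₗᵢ ((ℝ ∙ u)ᗮ.orthogonalProjectionOnto (R a)) +
      f ((ℝ ∙ u)ᗮ.orthogonalProjectionOnto (R a)) • u = R a := by
    have := congrArg R hpf
    simpa using this
  set ι := ((ℝ ∙ u)ᗮ).subtypeₗᵢ
  set P := (ℝ ∙ u)ᗮ.orthogonalProjectionOnto
  have hya : (P ∘L (R.symm.symm.toContinuousLinearEquiv : E →L[ℝ] E)) a = P (R a) := rfl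
  rw [hya] at hyh hhval
  have hx : ι (P (R a) + P b) + h (P (R a) + P b) • u = R a + b := by
    rw [hhval, map_add ι, add_smul, add_add_add_comm, hpa, hpg]
  -- An inward ray for `B` at `b`, translated by `R a`, is one for the sum.
  obtain ⟨ε, hε, hεint⟩ := hGg.exists_sub_smul_mem_interior hfr hB.convex hB.nonempty_interior hyg
    ((hg _ hyg).1.differentiableAt (by simp)) hg0
  rw [hpg] at hεint
  have hεint' : R a + b - ε • u ∈ interior (R '' A + B) := by
    rw [add_sub_assoc]
    exact subset_interior_add_right (Set.add_mem_add (mem_image_of_mem R ha) hεint)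
  obtain ⟨U, hU, hxU, hiff⟩ := hGh.exists_isOpen_mem_frontier_iff hfr hconv hcomp.isClosed hyh hε
    (by rwa [hx])
  rw [hx] at hxU
  refine ⟨u, hu1, h, V'', U, hGh.isOpen, ?_, (isCkaOn_iff_forall_ckaAt hGh.isOpen).2 hh, hU, hxU,
    hiff⟩
  rw [map_add]
  exact hyh

end MinkowskiSum

/-! ### Generic rotations: density through reflections, and Baire category in `SO(n)`. -/

section Rotations

open Filter Matrix

variable {n : ℕ}

/-- The matrix of the reflection in the hyperplane orthogonal to `w`. -/
noncomputable def reflectionMatrix (w : Fin n → ℝ) : Matrix (Fin n) (Fin n) ℝ :=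
  1 - (2 / (w ⬝ᵥ w)) • vecMulVec w w

lemma reflectionMatrix_mulVec (w v : Fin n → ℝ) :
    reflectionMatrix w *ᵥ v = v - (2 / (w ⬝ᵥ w) * (w ⬝ᵥ v)) • w := by
  rw [reflectionMatrix, sub_mulVec, one_mulVec, smul_mulVec, vecMulVec_mulVec,
    op_smul_eq_smul, smul_smul]

lemma reflectionMatrix_transpose (w : Fin n → ℝ) :
    (reflectionMatrix w)ᵀ = reflectionMatrix w := by
  simp [reflectionMatrix, transpose_vecMulVec]

lemma reflectionMatrix_mul_self {w : Fin n → ℝ} (hw : w ⬝ᵥ w ≠ 0) :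
    reflectionMatrix w * reflectionMatrix w = 1 := by
  refine ext_of_mulVec_single fun i => ?_
  rw [← mulVec_mulVec, reflectionMatrix_mulVec, reflectionMatrix_mulVec, one_mulVec,
    dotProduct_sub, dotProduct_smul]
  ext j
  simp only [Pi.sub_apply, Pi.smul_apply, smul_eq_mul]
  field_simp
  ring

lemma det_reflectionMatrix {w : Fin n → ℝ} (hw : w ⬝ᵥ w ≠ 0) : (reflectionMatrix w).det = -1 := by
  have h : reflectionMatrix w =
      1 + replicateCol Unit (-(2 / (w ⬝ᵥ w)) • w) * replicateRow Unit w := by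
    ext i j
    simp [reflectionMatrix, vecMulVec_apply, mul_apply, sub_eq_add_neg, mul_assoc]
  rw [h, det_one_add_replicateCol_mul_replicateRow, dotProduct_smul, smul_eq_mul]
  field_simp
  norm_num

lemma reflectionMatrix_mul_mem {v w : Fin n → ℝ} (hv : v ⬝ᵥ v ≠ 0) (hw : w ⬝ᵥ w ≠ 0) :
    reflectionMatrix v * reflectionMatrix w ∈ specialOrthogonalGroup (Fin n) ℝ := by
  rw [mem_specialOrthogonalGroup_iff, mem_orthogonalGroup_iff]
  constructor
  · rw [transpose_mul, reflectionMatrix_transpose, reflectionMatrix_transpose, ← mul_assoc,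
      mul_assoc (reflectionMatrix v), reflectionMatrix_mul_self hw, mul_one,
      reflectionMatrix_mul_self hv]
  · rw [det_mul, det_reflectionMatrix hv, det_reflectionMatrix hw]
    norm_num

lemma continuousAt_reflectionMatrix {w : Fin n → ℝ} (hw : w ⬝ᵥ w ≠ 0) :
    ContinuousAt reflectionMatrix w := by
  have h1 : Continuous fun w : Fin n → ℝ => w ⬝ᵥ w := continuous_id.dotProduct continuous_id
  have h2 : Continuous fun w : Fin n → ℝ => vecMulVec w w :=
    continuous_id.matrix_vecMulVec continuous_id
  exact continuousAt_const.sub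
    ((continuousAt_const.div h1.continuousAt hw).smul h2.continuousAt)

namespace Matrix.specialOrthogonalGroup

lemma transpose_mul_self (R : specialOrthogonalGroup (Fin n) ℝ) :
    (R : Matrix (Fin n) (Fin n) ℝ)ᵀ * R = 1 :=
  (mem_orthogonalGroup_iff' _ _).1 (mem_specialOrthogonalGroup_iff.1 R.2).1

/-- The rotation of `ℝⁿ` with matrix `R`. -/
noncomputable def toIsometry (R : specialOrthogonalGroup (Fin n) ℝ) :
    EuclideanSpace ℝ (Fin n) ≃ₗᵢ[ℝ] EuclideanSpace ℝ (Fin n) :=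
  LinearIsometry.toLinearIsometryEquiv
    { toLinearMap := toEuclideanLin (R : Matrix (Fin n) (Fin n) ℝ)
      norm_map' := fun x => by
        have hsq : ∀ z : EuclideanSpace ℝ (Fin n), ‖z‖ ^ 2 = z.ofLp ⬝ᵥ z.ofLp := fun z => by
          rw [EuclideanSpace.real_norm_sq_eq]
          simp [dotProduct, sq]
        rw [← sq_eq_sq₀ (norm_nonneg _) (norm_nonneg _), hsq, hsq, ofLp_toLpLin, toLin'_apply,
          dotProduct_mulVec, ← mulVec_transpose, mulVec_mulVec, transpose_mul_self, one_mulVec] }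
    rfl

lemma toIsometry_apply (R : specialOrthogonalGroup (Fin n) ℝ) (x : EuclideanSpace ℝ (Fin n)) :
    toIsometry R x = toEuclideanLin (R : Matrix (Fin n) (Fin n) ℝ) x := rfl

lemma continuous_toIsometry_apply (x : EuclideanSpace ℝ (Fin n)) :
    Continuous fun R : specialOrthogonalGroup (Fin n) ℝ => toIsometry R x := by
  simp only [toIsometry_apply, toLpLin_apply]
  exact (PiLp.continuous_toLp 2 _).comp (continuous_subtype_val.matrix_mulVec continuous_const)

/-- Transposition (that is, inversion) as a homeomorphism of `SO(n)`. -/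
def transposeHomeomorph : specialOrthogonalGroup (Fin n) ℝ ≃ₜ specialOrthogonalGroup (Fin n) ℝ :=
  have hmem : ∀ R : specialOrthogonalGroup (Fin n) ℝ,
      (R : Matrix (Fin n) (Fin n) ℝ)ᵀ ∈ specialOrthogonalGroup (Fin n) ℝ := fun R => by
    rw [mem_specialOrthogonalGroup_iff, mem_orthogonalGroup_iff, transpose_transpose,
      det_transpose]
    exact ⟨transpose_mul_self R, (mem_specialOrthogonalGroup_iff.1 R.2).2⟩
  have hcont : Continuous fun R : specialOrthogonalGroup (Fin n) ℝ =>
      (⟨(R : Matrix (Fin n) (Fin n) ℝ)ᵀ, hmem R⟩ : specialOrthogonalGroup (Fin n) ℝ) :=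
    continuous_subtype_val.matrix_transpose.subtype_mk _
  { toFun := fun R => ⟨(R : Matrix (Fin n) (Fin n) ℝ)ᵀ, hmem R⟩
    invFun := fun R => ⟨(R : Matrix (Fin n) (Fin n) ℝ)ᵀ, hmem R⟩
    left_inv := fun R => Subtype.ext (transpose_transpose _)
    right_inv := fun R => Subtype.ext (transpose_transpose _)
    continuous_toFun := hcont
    continuous_invFun := hcont }

lemma toIsometry_transpose_toIsometry (R : specialOrthogonalGroup (Fin n) ℝ)
    (x : EuclideanSpace ℝ (Fin n)) :
    toIsometry (transposeHomeomorph R) (toIsometry R x) = x := by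
  simp only [toIsometry_apply, toLpLin_apply]
  change WithLp.toLp 2 ((R : Matrix (Fin n) (Fin n) ℝ)ᵀ *ᵥ (R : Matrix (Fin n) (Fin n) ℝ) *ᵥ
    x.ofLp) = x
  rw [mulVec_mulVec, transpose_mul_self, one_mulVec]

/-- The group is closed in the space of matrices, hence locally compact Hausdorff. -/
lemma baireSpace : BaireSpace (specialOrthogonalGroup (Fin n) ℝ) := by
  have hcl : IsClosed (specialOrthogonalGroup (Fin n) ℝ : Set (Matrix (Fin n) (Fin n) ℝ)) := by
    have : (specialOrthogonalGroup (Fin n) ℝ : Set (Matrix (Fin n) (Fin n) ℝ)) =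
        {M | M * Mᵀ = 1} ∩ {M | M.det = 1} := by
      ext M
      rw [SetLike.mem_coe, mem_specialOrthogonalGroup_iff, mem_orthogonalGroup_iff]
      rfl
    rw [this]
    exact (isClosed_eq (continuous_id.matrix_mul continuous_id.matrix_transpose)
      continuous_const).inter (isClosed_eq continuous_id.matrix_det continuous_const)
  have : LocallyCompactSpace (Matrix (Fin n) (Fin n) ℝ) :=
    inferInstanceAs (LocallyCompactSpace (Fin n → Fin n → ℝ))
  have := hcl.isClosedEmbedding_subtypeVal.locallyCompactSpace
  infer_instance

/-- The rotations that take a given unit vector out of a thin closed set are dense. -/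
lemma dense_toIsometry_notMem {T : Set (EuclideanSpace ℝ (Fin n))} (hT : IsClosedThinInSphere T)
    {v₀ : EuclideanSpace ℝ (Fin n)} (hv₀ : ‖v₀‖ = 1) :
    Dense {R : specialOrthogonalGroup (Fin n) ℝ | toIsometry R v₀ ∉ T} := by
  intro R₀
  rw [mem_closure_iff_nhds]
  intro O hO
  obtain ⟨O', hO', hOO'⟩ := mem_nhds_subtype _ _ _ |>.1 hO
  set a := toIsometry R₀ v₀ with ha
  have hdot : ∀ z : EuclideanSpace ℝ (Fin n), ‖z‖ = 1 → z.ofLp ⬝ᵥ z.ofLp = 1 := fun z hz => by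
    have := EuclideanSpace.real_norm_sq_eq z
    rw [hz] at this
    simpa [dotProduct, sq] using this.symm
  have ha1 : ‖a‖ = 1 := by rw [ha, LinearIsometryEquiv.norm_map, hv₀]
  have haa := hdot a ha1
  -- For a unit vector `b` near `a`, the first reflection sends `a` to `-a` and the second sends
  -- `-a` to `b`. Hence `S b` takes `v₀` to `b`; it lies in `SO(n)` and tends to `S a = R₀` as `b →
  -- a`.
  let S : EuclideanSpace ℝ (Fin n) → Matrix (Fin n) (Fin n) ℝ := fun b =>
    reflectionMatrix (a.ofLp + b.ofLp) * reflectionMatrix a.ofLp * R₀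
  have h2a : (a.ofLp + a.ofLp) ⬝ᵥ (a.ofLp + a.ofLp) ≠ 0 := by
    rw [add_dotProduct, dotProduct_add, haa]
    norm_num
  have hadd : Continuous fun b : EuclideanSpace ℝ (Fin n) => a.ofLp + b.ofLp :=
    continuous_const.add (PiLp.continuous_ofLp 2 _)
  have hSa : S a = R₀ := by
    have h1 : reflectionMatrix (a.ofLp + a.ofLp) = reflectionMatrix a.ofLp := by
      simp only [reflectionMatrix, add_dotProduct, dotProduct_add, haa]
      ext i j
      simp [vecMulVec_apply]
      ring
    simp only [S]
    rw [h1, reflectionMatrix_mul_self (by rw [haa]; exact one_ne_zero), one_mul]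
  have hSc : ContinuousAt S a := by
    have h1 : ContinuousAt (fun b : EuclideanSpace ℝ (Fin n) =>
        reflectionMatrix (a.ofLp + b.ofLp)) a :=
      ContinuousAt.comp (g := reflectionMatrix)
        (f := fun b : EuclideanSpace ℝ (Fin n) => a.ofLp + b.ofLp)
        (continuousAt_reflectionMatrix h2a) hadd.continuousAt
    exact (h1.mul continuousAt_const).mul continuousAt_const
  have hne : ∀ᶠ b in 𝓝 a, (a.ofLp + b.ofLp) ⬝ᵥ (a.ofLp + b.ofLp) ≠ 0 :=
    (hadd.dotProduct hadd).continuousAt.eventually_ne h2a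
  obtain ⟨ε, hε, hball⟩ := Metric.eventually_nhds_iff.1
    ((hSc.eventually (show O' ∈ 𝓝 (S a) by rw [hSa]; exact hO')).and hne)
  obtain ⟨v, hv1, hvε, hvT⟩ := hT.2 a ha1 ε hε
  obtain ⟨hvO, hvne⟩ := hball hvε
  have hvv := hdot v hv1
  let R : specialOrthogonalGroup (Fin n) ℝ :=
    ⟨S v, mul_mem (reflectionMatrix_mul_mem hvne (by rw [haa]; exact one_ne_zero)) R₀.2⟩
  refine ⟨R, hOO' hvO, ?_⟩
  have hRv : toIsometry R v₀ = v := by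
    have h1 : a.ofLp = (R₀ : Matrix (Fin n) (Fin n) ℝ) *ᵥ v₀.ofLp := rfl
    rw [toIsometry_apply, toLpLin_apply]
    change WithLp.toLp 2 ((reflectionMatrix (a.ofLp + v.ofLp) * reflectionMatrix a.ofLp *
      (R₀ : Matrix (Fin n) (Fin n) ℝ)) *ᵥ v₀.ofLp) = v
    rw [← mulVec_mulVec, ← h1, ← mulVec_mulVec, reflectionMatrix_mulVec, reflectionMatrix_mulVec]
    rw [add_dotProduct, dotProduct_add, dotProduct_add, hvv] at hvne ⊢
    have hcomm : v.ofLp ⬝ᵥ a.ofLp = a.ofLp ⬝ᵥ v.ofLp := dotProduct_comm _ _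
    simp only [dotProduct_sub, dotProduct_smul, add_dotProduct, haa, hcomm, smul_eq_mul] at hvne ⊢
    set c := a.ofLp ⬝ᵥ v.ofLp
    have h2 : (2 / (1 + c + (c + 1)) * (1 + c - 2 / 1 * 1 * (1 + c))) = -1 := by
      field_simp
      ring
    rw [h2]
    ext i
    simp
    ring
  rw [mem_ofPred_eq, hRv]
  exact hvT

end Matrix.specialOrthogonalGroup

open Matrix.specialOrthogonalGroup

lemma IsCkaConvexBody.norm_eq_one_of_mem_flatSphericalImage {E : Type} [NormedAddCommGroup E]
    [InnerProductSpace ℝ E] [CompleteSpace E] {k : WithTop ℕ∞} {α : ℝ≥0} {C : Set E}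
    (hC : IsCkaConvexBody k α C) {v : E} (hv : v ∈ flatSphericalImage C) : ‖v‖ = 1 := by
  obtain ⟨x, ⟨hx, -⟩, rfl⟩ := hv
  obtain ⟨n, hn0, hn⟩ := exists_ne_zero_inner_le hC.convex hC.nonempty_interior hx
  refine (Classical.epsilon_spec (p := IsUnitOuterNormal C x) ⟨‖n‖⁻¹ • n, ?_, fun a ha => ?_⟩).1
  · rw [norm_smul, norm_inv, norm_norm, inv_mul_cancel₀ (norm_ne_zero_iff.2 hn0)]
  · rw [real_inner_smul_left, real_inner_smul_left]
    exact mul_le_mul_of_nonneg_left (hn a ha) (inv_nonneg.2 (norm_nonneg _))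

/-- For a countable set `Z` of unit vectors and a countable family of thin closed sets, the rotations
that take `Z` off all members of the family contain a dense `Gδ` set. -/
lemma exists_isGδ_dense_toIsometry_notMem {Z : Set (EuclideanSpace ℝ (Fin n))} (hZ : Z.Countable)
    (hZ1 : ∀ v ∈ Z, ‖v‖ = 1) {𝒯 : Set (Set (EuclideanSpace ℝ (Fin n)))} (h𝒯 : 𝒯.Countable)
    (hT : ∀ T ∈ 𝒯, IsClosedThinInSphere T) :
    ∃ S : Set (specialOrthogonalGroup (Fin n) ℝ), IsGδ S ∧ Dense S ∧
      ∀ R ∈ S, ∀ v ∈ Z, toIsometry R v ∉ ⋃₀ 𝒯 := by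
  have := baireSpace (n := n)
  have hopen : ∀ q ∈ Z ×ˢ 𝒯, IsOpen {R : specialOrthogonalGroup (Fin n) ℝ |
      toIsometry R q.1 ∉ q.2} := fun q hq =>
    (hT _ hq.2).1.isOpen_compl.preimage (continuous_toIsometry_apply q.1)
  refine ⟨⋂ q ∈ Z ×ˢ 𝒯, {R | toIsometry R q.1 ∉ q.2}, ?_, ?_, ?_⟩
  · exact .biInter (hZ.prod h𝒯) fun q hq => (hopen q hq).isGδ
  · exact dense_biInter_of_isOpen hopen (hZ.prod h𝒯) fun q hq =>
      dense_toIsometry_notMem (hT _ hq.2) (hZ1 _ hq.1)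
  · rintro R hR v hv ⟨T, hT𝒯, hvT⟩
    exact mem_iInter₂.1 hR (v, T) ⟨hv, hT𝒯⟩ hvT

end Rotations

/-! ### The theorem: combination of regularity and genericity. -/

theorem theorem1p2 (n : ℕ) (k : WithTop ℕ∞) (hk : 2 ≤ k) (α : ℝ≥0) (hα : α ≤ 1)
    (A B : Set (EuclideanSpace ℝ (Fin n)))
    (hA : IsCkaConvexBody k α A) (hB : IsCkaConvexBody k α B)
    (hZ : (flatSphericalImage A).Countable ∨ (flatSphericalImage B).Countable) :
    ∃ S : Set (Matrix.specialOrthogonalGroup (Fin n) ℝ), IsGδ S ∧ Dense S ∧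
      S ⊆ {R | IsCkaConvexBody k α (rotate R A + B)} := by
  open Matrix.specialOrthogonalGroup in
  suffices ∃ S : Set (Matrix.specialOrthogonalGroup (Fin n) ℝ), IsGδ S ∧ Dense S ∧
      ∀ R ∈ S, ∀ v ∈ flatSphericalImage A, toIsometry R v ∉ flatSphericalImage B by
    obtain ⟨S, hS1, hS2, hS3⟩ := this
    exact ⟨S, hS1, hS2, fun R hR => hA.image_isometry_add hk hα hB (toIsometry R) (hS3 R hR)⟩
  rcases hZ with hZ | hZ
  · obtain ⟨𝒯, h𝒯, hcov, hT⟩ := hB.exists_thin_cover hk hα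
    obtain ⟨S, hS1, hS2, hS3⟩ := exists_isGδ_dense_toIsometry_notMem hZ
      (fun v hv => hA.norm_eq_one_of_mem_flatSphericalImage hv) h𝒯 hT
    exact ⟨S, hS1, hS2, fun R hR v hv hvB => hS3 R hR v hv (hcov hvB)⟩
  · obtain ⟨𝒯, h𝒯, hcov, hT⟩ := hA.exists_thin_cover hk hα
    obtain ⟨S, hS1, hS2, hS3⟩ := exists_isGδ_dense_toIsometry_notMem hZ
      (fun v hv => hB.norm_eq_one_of_mem_flatSphericalImage hv) h𝒯 hT
    -- Here `Z_B` is the countable set, so the generic condition is imposed on `R⁻¹ = Rᵀ`: it moves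
    -- `R v ∈ Z_B` off the cover of `Z_A`, yet returns `v ∈ Z_A`.
    refine ⟨transposeHomeomorph ⁻¹' S, hS1.preimage transposeHomeomorph.continuous,
      hS2.preimage transposeHomeomorph.isOpenMap, fun R hR v hv hvB => hS3 _ hR _ hvB ?_⟩
    rw [toIsometry_transpose_toIsometry]
    exact hcov hv
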